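/- **Theorem 1 (Entropy inequality for the resistive GLM-MHD equations).** Let $\gamma>1$, $\mu_{NS},\mu_R,\kappa\ge 0$, $R>0$, $c_h\in\mathbb{R}$ and $\alpha\ge 0$ be constants. Write the state as $\mathbf{u}=(\rho,\rho\vec v,E,\vec B,\psi)^T\in\mathbb{R}^9$ and put $$p=(\gamma-1)\Big(E-\tfrac12\rho\|\vec v\|^2-\tfrac12\|\vec B\|^2-\tfrac12\psi^2\Big).$$ In what follows the flux in the direction $x_\ell$ is listed in the order $(\rho,\rho v_k,E,B_k,\psi)$, with $k=1,2,3$. The advective flux is $$\mathbf{f}^a_\ell=\begin{pmatrix}\rho v_\ell\\ \rho v_\ell v_k+p\,\delta_{\ell k}+\tfrac12\|\vec B\|^2\delta_{\ell k}-B_\ell B_k\\ v_\ell\big(\tfrac12\rho\|\vec v\|^2+\tfrac{\gamma p}{\gamma-1}\big)+v_\ell\|\vec B\|^2-B_\ell(\vec v\cdot\vec B)+c_h\psi B_\ell\\ v_\ell B_k-B_\ell v_k+c_h\psi\,\delta_{\ell k}\\ c_hB_\ell\end{pmatrix},$$ and the viscous and resistive flux is $$\mathbf{f}^v_\ell=\begin{pmatrix}0\\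 \tau_{\ell k}\\ (\tau\vec v)_\ell+\kappa\,\partial_\ell\big(\tfrac{p}{R\rho}\big)-\mu_R\big((\nabla\times\vec B)\times\vec B\big)_\ell\\ \mu_R(\partial_\ell B_k-\partial_kB_\ell)\\ 0\end{pmatrix},\qquad \tau_{\ell k}=\mu_{NS}(\partial_\ell v_k+\partial_kv_\ell)-\tfrac23\mu_{NS}(\nabla\cdot\vec v)\,\delta_{\ell k}.$$ The non-conservative terms (Powell and GLM) and the damping source are $$\Upsilon=(\nabla\cdot\vec B)\,(0,\vec B,\vec v\cdot\vec B,\vec v,0)^T+\sum_{\ell=1}^3\partial_\ell\psi\,(0,\vec 0,v_\ell\psi,\vec 0,v_\ell)^T,\qquad \mathbf{r}=(0,\vec 0,0,\vec 0,-\alpha\psi)^T .$$ The entropy, the entropy variables and the entropy flux are $$S=-\frac{\rho s}{\gamma-1},\quad s=\ln(p\rho^{-\gamma}),\qquad \mathbf{w}=\frac{\partial S}{\partial\mathbf{u}},\qquad \vec f^{\,ent}=\vec v\,S .$$ Let $\Omega\subset\mathbb{R}^3$ be a bounded open set with Lipschitz boundary (locally, in suitable Cartesian coordinates, the region below the graph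 of a Lipschitz function), let $dS$ be the surface measure on $\partial\Omega$ (two-dimensional Hausdorff measure), and let $\vec n$ be the outward unit normal, which exists almost everywhere on $\partial\Omega$. Let $T\in\mathbb{R}$ and let $\mathbf{u}$ be of class $C^2$ on $(0,T)\times\overline\Omega$ (smooth up to the boundary), with $\rho>0$ and $p>0$ there, and satisfy $$\mathbf{u}_t+\nabla\cdot\mathbf{f}^a(\mathbf{u})-\nabla\cdot\mathbf{f}^v(\mathbf{u},\nabla\mathbf{u})+\Upsilon=\mathbf{r}\qquad\text{in }(0,T)\times\Omega .$$ Then, for every $t\in(0,T)$, the two integrands below are integrable and $$\int_\Omega S_t\,dV+\int_{\partial\Omega}\Big(\vec f^{\,ent}\cdot\vec n-\mathbf{w}^T(\mathbf{f}^v\cdot\vec n)\Big)\,dS\le 0 .$$ -/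

import Mathlib

open Set Filter Topology MeasureTheory
open scoped NNReal Matrix

noncomputable section

namespace GLMMHD

/-- Physical space `ℝ³` with the Euclidean norm. -/
abbrev Space := EuclideanSpace ℝ (Fin 3)

/-- The state space `ℝ⁹`, ordered as `(ρ, ρ v₁, ρ v₂, ρ v₃, E, B₁, B₂, B₃, ψ)`. -/
abbrev State := Fin 9 → ℝ

/-- The constants of the resistive GLM-MHD system: the adiabatic coefficient, the viscosity, the
resistivity, the thermal conductivity, the gas constant, the divergence cleaning speed and the
damping parameter. Sign conditions are imposed separately. -/
structure Constants where
  adiabatic : ℝ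
  viscosity : ℝ
  resistivity : ℝ
  conductivity : ℝ
  gasConst : ℝ
  cleaningSpeed : ℝ
  damping : ℝ

/-! ### Geometry of the domain -/

/-- A bounded open set which, near each boundary point and in suitable Cartesian coordinates, is
the region strictly below the graph of a Lipschitz function of two variables. -/
structure IsBoundedLipschitzDomain (Ω : Set Space) : Prop where
  isOpen : IsOpen Ω
  isBounded : Bornology.IsBounded Ω
  exists_graph : ∀ x ∈ frontier Ω, ∃ (b : OrthonormalBasis (Fin 3) ℝ Space)
    (φ : EuclideanSpace ℝ (Fin 2) → ℝ) (L : ℝ≥0), LipschitzWith L φ ∧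
      ∀ᶠ y in 𝓝 x, (y ∈ Ω ↔ b.repr y 2 < φ !₂[b.repr y 0, b.repr y 1])

/-- `ν` is the outward unit normal of `Ω` at `x`: for every `ε > 0`, all points `y` close enough
to `x` that lie in the cone `⟪y - x, ν⟫ < - ε ‖y - x‖` belong to `Ω`, and all those in the
opposite cone `⟪y - x, ν⟫ > ε ‖y - x‖` do not. -/
def IsOutwardUnitNormal (Ω : Set Space) (x ν : Space) : Prop :=
  ‖ν‖ = 1 ∧ ∀ ε : ℝ, 0 < ε → ∀ᶠ y in 𝓝 x,
    (inner ℝ (y - x) ν < -(ε * ‖y - x‖) → y ∈ Ω) ∧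
    (ε * ‖y - x‖ < inner ℝ (y - x) ν → y ∉ Ω)

/-- There is at most one outward unit normal at a point. -/
theorem IsOutwardUnitNormal.unique {Ω : Set Space} {x ν₁ ν₂ : Space}
    (h₁ : IsOutwardUnitNormal Ω x ν₁) (h₂ : IsOutwardUnitNormal Ω x ν₂) : ν₁ = ν₂ := by
  by_contra hne
  obtain ⟨n₁, h₁⟩ := h₁
  obtain ⟨n₂, h₂⟩ := h₂
  have hlt : inner ℝ ν₁ ν₂ < 1 := (inner_lt_one_iff_real_of_norm_eq_one n₁ n₂).2 hne
  set c := inner ℝ ν₁ ν₂ with hc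
  have e₁ : inner ℝ (ν₁ - ν₂) ν₁ = 1 - c := by
    rw [inner_sub_left, real_inner_self_eq_norm_sq, n₁, real_inner_comm, one_pow, hc]
  have e₂ : inner ℝ (ν₁ - ν₂) ν₂ = c - 1 := by
    rw [inner_sub_left, real_inner_self_eq_norm_sq, n₂, one_pow, hc]
  have hd : ‖ν₁ - ν₂‖ ≤ 2 := by linarith [norm_sub_le ν₁ ν₂]
  have hε : 0 < (1 - c) / 4 := by linarith
  have hlim : Tendsto (fun s : ℝ => x + s • (ν₁ - ν₂)) (𝓝[>] 0) (𝓝 x) := by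
    have : Continuous fun s : ℝ => x + s • (ν₁ - ν₂) := by fun_prop
    simpa using (this.tendsto 0).mono_left nhdsWithin_le_nhds
  obtain ⟨s, ⟨ha, hb⟩, hs⟩ := ((hlim.eventually ((h₁ _ hε).and (h₂ _ hε))).and
    self_mem_nhdsWithin).exists
  have hs' : 0 < s := hs
  have hn : (1 - c) / 4 * ‖s • (ν₁ - ν₂)‖ < s * (1 - c) := by
    rw [norm_smul, Real.norm_of_nonneg hs'.le]
    nlinarith [mul_pos hs' (sub_pos.2 hlt), mul_le_mul_of_nonneg_left hd (mul_pos hs' hε).le]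
  refine ha.2 ?_ (hb.1 ?_)
  · rw [add_sub_cancel_left, real_inner_smul_left, e₁]; exact hn
  · rw [add_sub_cancel_left, real_inner_smul_left, e₂]; linarith

open Classical in
/-- The outward unit normal field of `Ω`; it has the value `0` where there is no such normal. -/
def outwardNormal (Ω : Set Space) (x : Space) : Space :=
  if h : ∃ ν, IsOutwardUnitNormal Ω x ν then h.choose else 0

/-- The surface measure on `∂Ω`: the two-dimensional Hausdorff measure, normalized so that it is
Lebesgue measure on planes, restricted to `∂Ω`. -/
def surfaceMeasure (Ω : Set Space) : Measure Space :=
  μHE[2].restrict (frontier Ω)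

/-! ### Differential operators

All operators are relative to a set `K`, which below is the closed set `closure Ω`. At points of
the open set `Ω` they are the usual ones; at boundary points they are the one-sided derivatives,
that is, the continuous extensions of the derivatives from `Ω`. -/

/-- The partial derivative `∂f/∂x_i`. -/
def pd {F : Type*} [NormedAddCommGroup F] [NormedSpace ℝ F]
    (K : Set Space) (i : Fin 3) (f : Space → F) (x : Space) : F :=
  fderivWithin ℝ f K x (EuclideanSpace.single i 1)

/-- The divergence of a block vector with blocks `f 0, f 1, f 2`. -/
def blockDiv {F : Type*} [NormedAddCommGroup F] [NormedSpace ℝ F]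
    (K : Set Space) (f : Space → Fin 3 → F) (x : Space) : F :=
  ∑ i, pd K i (fun y => f y i) x

/-- The gradient of a spatial vector field, `(∇V)_{ij} = ∂V_i/∂x_j`. -/
def gradVec (K : Set Space) (V : Space → Fin 3 → ℝ) (x : Space) : Matrix (Fin 3) (Fin 3) ℝ :=
  Matrix.of fun i j => pd K j (fun y => V y i) x

/-- The curl of a spatial vector field. -/
def curl (K : Set Space) (V : Space → Fin 3 → ℝ) (x : Space) : Fin 3 → ℝ :=
  ![pd K 1 (fun y => V y 2) x - pd K 2 (fun y => V y 1) x,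
    pd K 2 (fun y => V y 0) x - pd K 0 (fun y => V y 2) x,
    pd K 0 (fun y => V y 1) x - pd K 1 (fun y => V y 0) x]

/-! ### Physical quantities -/

/-- The state vector with the given density, momentum, energy, magnetic and `ψ` components. -/
def mkState (a : ℝ) (m : Fin 3 → ℝ) (e : ℝ) (b : Fin 3 → ℝ) (z : ℝ) : State :=
  ![a, m 0, m 1, m 2, e, b 0, b 1, b 2, z]

/-- The mass density `ρ`. -/
def density (u : State) : ℝ := u 0

/-- The velocity `v`. -/
def velocity (u : State) : Fin 3 → ℝ := ![u 1 / u 0, u 2 / u 0, u 3 / u 0]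

/-- The total energy `E`. -/
def energy (u : State) : ℝ := u 4

/-- The magnetic field `B`. -/
def magnetic (u : State) : Fin 3 → ℝ := ![u 5, u 6, u 7]

/-- The divergence cleaning variable `ψ`. -/
def cleaning (u : State) : ℝ := u 8

/-- The pressure `p`, from the ideal gas law. -/
def pressure (c : Constants) (u : State) : ℝ :=
  (c.adiabatic - 1) * (energy u - 1 / 2 * density u * (velocity u ⬝ᵥ velocity u)
    - 1 / 2 * (magnetic u ⬝ᵥ magnetic u) - 1 / 2 * cleaning u ^ 2)

/-! ### The fluxes

The `ℓ`-th block of a flux is the flux in the direction `x_ℓ`. In the `3 × 3` blocks the row is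
the direction of the flux and the column is the component of the state. -/

/-- The Euler part of the advective flux. -/
def eulerFlux (c : Constants) (u : State) (l : Fin 3) : State :=
  mkState (density u * velocity u l)
    (fun k => density u * velocity u l * velocity u k
      + pressure c u * (1 : Matrix (Fin 3) (Fin 3) ℝ) l k)
    (velocity u l * (1 / 2 * density u * (velocity u ⬝ᵥ velocity u)
      + c.adiabatic * pressure c u / (c.adiabatic - 1)))
    0 0

/-- The ideal MHD part of the advective flux. -/
def mhdFlux (u : State) (l : Fin 3) : State :=
  mkState 0
    (fun k => 1 / 2 * (magnetic u ⬝ᵥ magnetic u) * (1 : Matrix (Fin 3) (Fin 3) ℝ) l k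
      - magnetic u l * magnetic u k)
    (velocity u l * (magnetic u ⬝ᵥ magnetic u) - magnetic u l * (velocity u ⬝ᵥ magnetic u))
    (fun k => velocity u l * magnetic u k - magnetic u l * velocity u k)
    0

/-- The divergence cleaning part of the advective flux. -/
def glmFlux (c : Constants) (u : State) (l : Fin 3) : State :=
  mkState 0 0
    (c.cleaningSpeed * cleaning u * magnetic u l)
    (fun k => c.cleaningSpeed * cleaning u * (1 : Matrix (Fin 3) (Fin 3) ℝ) l k)
    (c.cleaningSpeed * magnetic u l)

/-- The advective flux. -/
def advectiveFlux (c : Constants) (u : State) (l : Fin 3) : State :=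
  eulerFlux c u l + mhdFlux u l + glmFlux c u l

/-- The viscous stress tensor `μ ((∇v)ᵀ + ∇v) - (2/3) μ (∇ · v) I`. -/
def stress (c : Constants) (K : Set Space) (U : Space → State) (x : Space) :
    Matrix (Fin 3) (Fin 3) ℝ :=
  c.viscosity • ((gradVec K (fun y => velocity (U y)) x)ᵀ + gradVec K (fun y => velocity (U y)) x)
    - (2 / 3 * c.viscosity * blockDiv K (fun y => velocity (U y)) x) •
      (1 : Matrix (Fin 3) (Fin 3) ℝ)

/-- The heat flux `-κ ∇(p / (R ρ))`. -/
def heatFlux (c : Constants) (K : Set Space) (U : Space → State) (x : Space) (l : Fin 3) : ℝ :=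
  -c.conductivity * pd K l (fun y => pressure c (U y) / (c.gasConst * density (U y))) x

/-- The viscous and resistive flux of the state field `U`. -/
def viscousFlux (c : Constants) (K : Set Space) (U : Space → State) (x : Space) (l : Fin 3) :
    State :=
  mkState 0
    (fun k => stress c K U x l k)
    ((stress c K U x *ᵥ velocity (U x)) l - heatFlux c K U x l
      - c.resistivity * (crossProduct (curl K (fun y => magnetic (U y)) x) (magnetic (U x))) l)
    (fun k => c.resistivity * ((gradVec K (fun y => magnetic (U y)) x)ᵀ
      - gradVec K (fun y => magnetic (U y)) x) l k)
    0

/-! ### Non-conservative terms and damping -/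

/-- The Powell term. -/
def powellTerm (K : Set Space) (U : Space → State) (x : Space) : State :=
  blockDiv K (fun y => magnetic (U y)) x •
    mkState 0 (magnetic (U x)) (velocity (U x) ⬝ᵥ magnetic (U x)) (velocity (U x)) 0

/-- The non-conservative term of the divergence cleaning. -/
def glmTerm (K : Set Space) (U : Space → State) (x : Space) : State :=
  ∑ l, pd K l (fun y => cleaning (U y)) x •
    mkState 0 0 (velocity (U x) l * cleaning (U x)) 0 (velocity (U x) l)

/-- The damping source term. -/
def dampingTerm (c : Constants) (u : State) : State :=
  mkState 0 0 0 0 (-c.damping * cleaning u)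

/-- `u` is a classical solution, up to the boundary of `Ω` and with positive density and pressure,
of the resistive GLM-MHD system on the time interval `(0, T)`. -/
structure IsSolution (c : Constants) (Ω : Set Space) (T : ℝ) (u : ℝ → Space → State) : Prop where
  contDiffOn : ContDiffOn ℝ 2 (fun q : ℝ × Space => u q.1 q.2) (Ioo 0 T ×ˢ closure Ω)
  density_pos : ∀ t ∈ Ioo 0 T, ∀ x ∈ closure Ω, 0 < density (u t x)
  pressure_pos : ∀ t ∈ Ioo 0 T, ∀ x ∈ closure Ω, 0 < pressure c (u t x)
  equation : ∀ t ∈ Ioo 0 T, ∀ x ∈ Ω,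
    deriv (fun s => u s x) t
      + blockDiv (closure Ω) (fun y => advectiveFlux c (u t y)) x
      - blockDiv (closure Ω) (viscousFlux c (closure Ω) (u t)) x
      + (powellTerm (closure Ω) (u t) x + glmTerm (closure Ω) (u t) x)
    = dampingTerm c (u t x)

/-! ### Entropy -/

/-- The entropy function `S = - ρ s / (γ - 1)` with `s = ln (p ρ ^ (-γ))`. -/
def entropy (c : Constants) (u : State) : ℝ :=
  -(density u * Real.log (pressure c u * density u ^ (-c.adiabatic))) / (c.adiabatic - 1)

/-- The entropy variables `w = ∂S/∂u`. -/
def entropyVars (c : Constants) (u : State) : State :=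
  fun k => fderiv ℝ (entropy c) u (Pi.single k 1)

/-- The entropy flux `v S`. -/
def entropyFlux (c : Constants) (u : State) : Fin 3 → ℝ :=
  entropy c u • velocity u

/-- The boundary integrand `f^ent · n - wᵀ (f^v · n)`, with `n` the outward unit normal. -/
def boundaryFlux (c : Constants) (Ω : Set Space) (U : Space → State) (x : Space) : ℝ :=
  (∑ l, entropyFlux c (U x) l * outwardNormal Ω x l)
    - entropyVars c (U x) ⬝ᵥ (∑ l, outwardNormal Ω x l • viscousFlux c (closure Ω) U x l)

end GLMMHD

end

/-!
The proof has an analytic part, the divergence theorem on a bounded Lipschitz domain, and an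
algebraic part, the pointwise entropy balance.

*Divergence theorem.* For `G` of class `C¹` up to the boundary and a constant vector `v`,
`∫_Ω ∂_v G = ∫_{∂Ω} G ⟪v, n⟫ dS` (`IsBoundedLipschitzDomain.integral_fderivWithin`). A finite
partition of unity reduces this to functions that vanish near `∂Ω`, for which both sides are zero,
and to functions supported where `Ω` is the region below the graph of a Lipschitz function `φ`.
In the latter case a shear flattens the graph. The tangential derivative of `G` along each parallel
graph is the derivative of a compactly supported Lipschitz function, so it integrates to zero, and
the vertical derivative is integrated by the fundamental theorem of calculus. The result is an
integral over the parameter plane against the vector `(-∇φ, 1)`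
(`integral_fderiv_subgraph`). By Rademacher's theorem `φ` is differentiable almost everywhere, and
where it is, `(-∇φ, 1)` is `√(1 + ‖∇φ‖²)` times the outward unit normal
(`IsGraphChart.outwardNormal_eq`). The factor is the density of the Hausdorff measure in the graph
parametrization (`IsGraphMap.restrict_range_eq_map`): on a set where `φ` is within `δ` of a linear
form, its graph is bi-Lipschitz with constant `1 + δ` to the graph of that form, and the latter is
isometric to the image of an endomorphism of the plane whose determinant is the factor.

*Entropy balance.* The entropy variables have an explicit form (`entropyVars_eq`). Contracted with
them, the advective flux and the non-conservative terms give, in each coordinate direction, the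
derivative of the entropy flux (`HasPrimitiveDerivAt.hasDerivAt_entropyFlux`). Hence
`S_t + ∇ · (f^ent - wᵀ f^v)` is equal to `-α ρ ψ² / p` minus the contraction of `f^v` with the
gradient of `w`. That contraction is a nonnegative combination of squares: of the trace-free strain
rates, of the current, and of the gradient of `ρ / p`
(`entropyVarsFormula_dotProduct_add_sum_pd_le`). The theorem follows by integrating over `Ω`.
-/

namespace GLMMHD

open scoped ENNReal

/-! ### The area formula for Lipschitz graphs -/

section AreaFormula

/-- The factor by which the graph of a function with derivative `A` stretches the area. -/
noncomputable def graphJacobian {E : Type*} [NormedAddCommGroup E] [NormedSpace ℝ E]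
    (A : E →L[ℝ] ℝ) : ℝ :=
  Real.sqrt (1 + ‖A‖ ^ 2)

section

variable {E : Type*} [NormedAddCommGroup E] [NormedSpace ℝ E]

theorem graphJacobian_sq (A : E →L[ℝ] ℝ) : graphJacobian A ^ 2 = 1 + ‖A‖ ^ 2 :=
  Real.sq_sqrt (by positivity)

theorem one_le_graphJacobian (A : E →L[ℝ] ℝ) : 1 ≤ graphJacobian A :=
  Real.one_le_sqrt.2 (by nlinarith [sq_nonneg ‖A‖])

theorem graphJacobian_pos (A : E →L[ℝ] ℝ) : 0 < graphJacobian A :=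
  zero_lt_one.trans_le (one_le_graphJacobian A)

theorem continuous_graphJacobian : Continuous (graphJacobian : (E →L[ℝ] ℝ) → ℝ) := by
  unfold graphJacobian
  fun_prop

theorem graphJacobian_le_mul {A B : E →L[ℝ] ℝ} {δ : ℝ} (h : ‖A - B‖ ≤ δ) :
    graphJacobian A ≤ (1 + δ) * graphJacobian B := by
  have hδ : 0 ≤ δ := (norm_nonneg _).trans h
  have h₁ : ‖A‖ ≤ ‖B‖ + δ := by
    have := norm_add_le (A - B) B
    rw [sub_add_cancel] at this
    linarith
  have h₂ : ‖B‖ ≤ graphJacobian B := Real.le_sqrt_of_sq_le (by linarith)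
  have h₃ := one_le_graphJacobian B
  refine Real.sqrt_le_iff.2 ⟨by positivity, ?_⟩
  have h₄ : ‖A‖ ^ 2 ≤ (‖B‖ + δ) ^ 2 := by gcongr
  have h₅ := graphJacobian_sq B
  nlinarith [mul_le_mul_of_nonneg_left h₂ hδ, mul_le_mul_of_nonneg_left h₃ hδ,
    mul_nonneg hδ (mul_nonneg (sub_nonneg.2 h₃) (by linarith : (0:ℝ) ≤ graphJacobian B)),
    mul_nonneg (mul_nonneg hδ hδ) (by nlinarith : (0:ℝ) ≤ graphJacobian B ^ 2 - 1)]

end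

/-- The graph map of a linear form `A` is, up to an isometry, an endomorphism whose determinant is
the Jacobian of the graph: a dilation in the direction of the gradient. -/
theorem exists_linearMap_norm_sq {E : Type*} [NormedAddCommGroup E] [InnerProductSpace ℝ E]
    [FiniteDimensional ℝ E] (A : E →L[ℝ] ℝ) :
    ∃ P : E →ₗ[ℝ] E, (∀ w, ‖P w‖ ^ 2 = ‖w‖ ^ 2 + A w ^ 2) ∧ P.det = graphJacobian A := by
  set a : E := (InnerProductSpace.toDual ℝ E).symm A with ha
  have hA : ∀ w, inner ℝ a w = A w := fun w => by simp [ha]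
  have hn : ‖a‖ = ‖A‖ := by simp [ha]
  have hJ := graphJacobian_sq A
  have hJ1 := one_le_graphJacobian A
  set J := graphJacobian A with hJdef
  have hc : (1 + J)⁻¹ * ‖A‖ ^ 2 = J - 1 := by
    field_simp
    nlinarith
  refine ⟨LinearMap.transvection (A : E →ₗ[ℝ] ℝ) ((1 + J)⁻¹ • a), fun w => ?_, ?_⟩
  · have : LinearMap.transvection (A : E →ₗ[ℝ] ℝ) ((1 + J)⁻¹ • a) w
        = w + (A w * (1 + J)⁻¹) • a := by
      simp [LinearMap.transvection, smul_smul]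
    rw [this, norm_add_sq_real, inner_smul_right, real_inner_comm, hA, norm_smul, mul_pow, hn,
      Real.norm_eq_abs, sq_abs]
    have h2 : (1 + J)⁻¹ * (2 + (J - 1)) = 1 := by
      field_simp
      ring
    linear_combination (A w) ^ 2 * ((1 + J)⁻¹ * hc + h2)
  · rw [LinearMap.transvection.det]
    have : (A : E →ₗ[ℝ] ℝ) ((1 + J)⁻¹ • a) = (1 + J)⁻¹ * ‖A‖ ^ 2 := by
      simp only [ContinuousLinearMap.coe_coe, map_smul, smul_eq_mul]
      rw [← hA a, real_inner_self_eq_norm_sq, hn]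
    rw [this, hc]
    ring

/-- A map that is Lipschitz with respect to the distance measured after another map compares the
Hausdorff measures of the two images. -/
theorem euclideanHausdorffMeasure_image_le_of_edist_le {α X Y : Type*}
    [EMetricSpace X] [MeasurableSpace X] [BorelSpace X]
    [EMetricSpace Y] [MeasurableSpace Y] [BorelSpace Y] (d : ℕ) {f : α → X} {g : α → Y}
    {s : Set α} {K : ℝ≥0} (h : ∀ a ∈ s, ∀ b ∈ s, edist (g a) (g b) ≤ K * edist (f a) (f b)) :
    μHE[d] (g '' s) ≤ (K : ℝ≥0∞) ^ d * μHE[d] (f '' s) := by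
  rcases s.eq_empty_or_nonempty with rfl | ⟨a₀, -⟩
  · simp
  classical
  let F : X → Y := fun x => if hx : ∃ a ∈ s, f a = x then g hx.choose else g a₀
  have hF : ∀ a ∈ s, F (f a) = g a := by
    intro a ha
    have hx : ∃ b ∈ s, f b = f a := ⟨a, ha, rfl⟩
    have hF' : F (f a) = g hx.choose := dif_pos hx
    rw [hF', ← edist_le_zero]
    refine (h _ hx.choose_spec.1 _ ha).trans ?_
    rw [hx.choose_spec.2, edist_self, mul_zero]
  have hL : LipschitzOnWith K F (f '' s) := by
    rintro _ ⟨a, ha, rfl⟩ _ ⟨b, hb, rfl⟩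
    rw [hF a ha, hF b hb]
    exact h a ha b hb
  have himg : F '' (f '' s) = g '' s := by
    rw [image_image]
    exact image_congr hF
  have := hL.hausdorffMeasure_image_le (d := (d : ℝ)) (Nat.cast_nonneg d)
  rw [himg, ENNReal.rpow_natCast] at this
  simp only [Measure.euclideanHausdorffMeasure_def, Measure.smul_apply, ENNReal.smul_def,
    smul_eq_mul]
  rw [mul_left_comm]
  gcongr

variable {d : ℕ} {X : Type*} [MetricSpace X]
  {φ : EuclideanSpace ℝ (Fin d) → ℝ} {ψ : EuclideanSpace ℝ (Fin d) → X}

/-- `ψ` is, up to an isometry, the graph map `y ↦ (y, φ y)`. -/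
def IsGraphMap (φ : EuclideanSpace ℝ (Fin d) → ℝ) (ψ : EuclideanSpace ℝ (Fin d) → X) : Prop :=
  ∀ y z, dist (ψ y) (ψ z) ^ 2 = dist y z ^ 2 + (φ y - φ z) ^ 2

theorem IsGraphMap.dist_le (hψ : IsGraphMap φ ψ) (y z : EuclideanSpace ℝ (Fin d)) :
    dist y z ≤ dist (ψ y) (ψ z) :=
  abs_le_of_sq_le_sq' (by rw [hψ]; nlinarith [sq_nonneg (φ y - φ z)]) dist_nonneg |>.2

theorem IsGraphMap.injective (hψ : IsGraphMap φ ψ) : Function.Injective ψ := fun y z h =>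
  dist_le_zero.1 ((hψ.dist_le y z).trans (by rw [h, dist_self]))

theorem IsGraphMap.lipschitzWith (hψ : IsGraphMap φ ψ) {L : ℝ≥0} (hφ : LipschitzWith L φ) :
    LipschitzWith (1 + L) ψ := by
  refine LipschitzWith.of_dist_le_mul fun y z => ?_
  refine abs_le_of_sq_le_sq' ?_ (by positivity) |>.2
  have h := hφ.dist_le_mul y z
  rw [Real.dist_eq] at h
  have h2 : (φ y - φ z) ^ 2 ≤ (L * dist y z) ^ 2 := by
    rw [← sq_abs]
    gcongr
  rw [hψ]
  push_cast
  nlinarith [mul_nonneg L.2 (sq_nonneg (dist y z))]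

theorem IsGraphMap.isClosedEmbedding (hψ : IsGraphMap φ ψ) {L : ℝ≥0} (hφ : LipschitzWith L φ) :
    IsClosedEmbedding ψ := by
  refine AntilipschitzWith.isClosedEmbedding (K := 1) (fun y z => ?_)
    (hψ.lipschitzWith hφ).uniformContinuous
  rw [ENNReal.coe_one, one_mul, edist_dist, edist_dist]
  exact ENNReal.ofReal_le_ofReal (hψ.dist_le y z)

theorem edist_le_mul_of_dist_le {Y Z : Type*} [PseudoMetricSpace Y] [PseudoMetricSpace Z]
    {a b : Y} {x y : Z} {K : ℝ≥0} (h : dist a b ≤ K * dist x y) :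
    edist a b ≤ K * edist x y := by
  rw [edist_dist, edist_dist, ← ENNReal.ofReal_coe_nnreal, ← ENNReal.ofReal_mul K.coe_nonneg]
  exact ENNReal.ofReal_le_ofReal h

variable [MeasurableSpace X] [BorelSpace X]

/-- On a set where `φ` is approximated by the linear form `A` up to `δ`, the graph of `φ` and the
graph of `A` are bi-Lipschitz equivalent with constant `1 + δ`. -/
theorem IsGraphMap.measure_image_of_approximatesLinearOn (hψ : IsGraphMap φ ψ)
    {A : EuclideanSpace ℝ (Fin d) →L[ℝ] ℝ} {s : Set (EuclideanSpace ℝ (Fin d))} {δ : ℝ≥0}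
    (hA : ApproximatesLinearOn φ A s δ) :
    μHE[d] (ψ '' s) ≤ (1 + δ : ℝ≥0) ^ d * (ENNReal.ofReal (graphJacobian A) * volume s) ∧
    ENNReal.ofReal (graphJacobian A) * volume s ≤ (1 + δ : ℝ≥0) ^ d * μHE[d] (ψ '' s) := by
  obtain ⟨P, hP, hdet⟩ := exists_linearMap_norm_sq A
  have hvol : μHE[d] (P '' s) = ENNReal.ofReal (graphJacobian A) * volume s := by
    rw [EuclideanSpace.euclideanHausdorffMeasure_eq_volume, Measure.addHaar_image_linearMap, hdet,
      abs_of_pos (graphJacobian_pos A)]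
  have key : ∀ y ∈ s, ∀ z ∈ s, |φ y - φ z - A (y - z)| ≤ δ * dist y z := by
    intro y hy z hz
    have := hA y hy z hz
    rwa [Real.norm_eq_abs, ← dist_eq_norm] at this
  have hPd : ∀ y z, dist (P y) (P z) ^ 2 = dist y z ^ 2 + A (y - z) ^ 2 := by
    intro y z
    rw [dist_eq_norm, ← map_sub, hP, dist_eq_norm]
  -- the triangle inequality for the vectors `(y - z, p)` and `(y - z, q)` of the plane
  have tri : ∀ {r p q D D' : ℝ}, 0 ≤ r → 0 ≤ D' → D' ^ 2 = r ^ 2 + p ^ 2 → D ^ 2 = r ^ 2 + q ^ 2 →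
      |q - p| ≤ δ * r → D ≤ (1 + δ : ℝ≥0) * D' := by
    intro r p q D D' hr hD' h1 h2 h3
    have hrD : r ≤ D' := abs_le_of_sq_le_sq' (by nlinarith [sq_nonneg p]) hD' |>.2
    have hpD : |p| ≤ D' := abs_le_of_sq_le_sq (by nlinarith [sq_nonneg r]) hD'
    have hq : |q| ≤ |p| + δ * r := by
      have := abs_add_le (q - p) p
      rw [sub_add_cancel] at this
      linarith
    have hδ := δ.2
    refine abs_le_of_sq_le_sq' ?_ (by positivity) |>.2
    push_cast
    have hq2 : q ^ 2 ≤ (|p| + δ * r) ^ 2 := by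
      rw [← sq_abs]
      gcongr
    have e1 : |p| * (δ * r) ≤ D' * (δ * D') := by gcongr
    have e2 : (δ * r) ^ 2 ≤ (δ * D') ^ 2 := by gcongr
    have e3 : |p| ^ 2 = p ^ 2 := sq_abs p
    nlinarith
  constructor
  · rw [← hvol]
    refine euclideanHausdorffMeasure_image_le_of_edist_le d fun y hy z hz =>
      edist_le_mul_of_dist_le ?_
    exact tri dist_nonneg dist_nonneg (hPd y z) (hψ y z) (key y hy z hz)
  · rw [← hvol]
    refine euclideanHausdorffMeasure_image_le_of_edist_le d fun y hy z hz =>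
      edist_le_mul_of_dist_le ?_
    exact tri dist_nonneg dist_nonneg (hψ y z) (hPd y z)
      (by rw [abs_sub_comm]; exact key y hy z hz)

theorem measurable_graphJacobian_fderiv (φ : EuclideanSpace ℝ (Fin d) → ℝ) :
    Measurable fun y => graphJacobian (fderiv ℝ φ y) :=
  continuous_graphJacobian.measurable.comp (measurable_fderiv ℝ φ)

/-- At almost every point of a set where `φ` is approximated by a linear form `A` up to `δ`, the
derivative of `φ` is within `δ` of `A`. -/
theorem ae_norm_fderiv_sub_le_of_approximatesLinearOn {s : Set (EuclideanSpace ℝ (Fin d))}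
    (hs : MeasurableSet s) {A : EuclideanSpace ℝ (Fin d) →L[ℝ] ℝ} {δ : ℝ≥0}
    (hA : ApproximatesLinearOn φ A s δ) (hd : ∀ y ∈ s, DifferentiableAt ℝ φ y) :
    ∀ᵐ y ∂volume.restrict s, ‖fderiv ℝ φ y - A‖ ≤ δ := by
  rcases isEmpty_or_nonempty (Fin d) with hE | ⟨⟨i⟩⟩
  · -- in dimension zero all linear forms vanish
    refine Eventually.of_forall fun y => ?_
    have : fderiv ℝ φ y - A = 0 := by
      ext w
      rw [Subsingleton.elim w 0]
      simp
    simp [this]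
  -- the corresponding fact in Mathlib is for endomorphisms
  set e : EuclideanSpace ℝ (Fin d) := EuclideanSpace.single i 1
  have he : ‖e‖ = 1 := by simp [e]
  have h1 : ApproximatesLinearOn (fun y => φ y • e) (A.smulRight e) s δ := by
    intro y hy z hz
    have := hA y hy z hz
    simpa [← sub_smul, norm_smul, he] using this
  have := h1.norm_fderiv_sub_le volume hs (fun y => (fderiv ℝ φ y).smulRight e) fun y hy =>
    ((hd y hy).hasFDerivAt.smul_const e).hasFDerivWithinAt
  filter_upwards [this] with y hy
  have h2 : (fderiv ℝ φ y).smulRight e - A.smulRight e = (fderiv ℝ φ y - A).smulRight e := by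
    ext1 w
    simp [sub_smul]
  rw [h2, ← NNReal.coe_le_coe, coe_nnnorm, ContinuousLinearMap.norm_smulRight_apply, he,
    mul_one] at hy
  exact hy

theorem IsGraphMap.measure_image_le_of_differentiableAt (hψ : IsGraphMap φ ψ) {L : ℝ≥0}
    (hφ : LipschitzWith L φ) {s : Set (EuclideanSpace ℝ (Fin d))} (hs : MeasurableSet s)
    (hd : ∀ y ∈ s, DifferentiableAt ℝ φ y) {δ : ℝ≥0} (hδ : 0 < δ) :
    μHE[d] (ψ '' s) ≤ (1 + δ : ℝ≥0) ^ (d + 1)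
        * ∫⁻ y in s, ENNReal.ofReal (graphJacobian (fderiv ℝ φ y)) ∧
    ∫⁻ y in s, ENNReal.ofReal (graphJacobian (fderiv ℝ φ y))
      ≤ (1 + δ : ℝ≥0) ^ (d + 1) * μHE[d] (ψ '' s) := by
  obtain ⟨t, A, hdisj, htm, hst, happ, -⟩ :=
    exists_partition_approximatesLinearOn_of_hasFDerivWithinAt φ s (fderiv ℝ φ)
      (fun y hy => (hd y hy).hasFDerivAt.hasFDerivWithinAt) (fun _ => δ) (fun _ => hδ.ne')
  have hm : ∀ n, MeasurableSet (s ∩ t n) := fun n => hs.inter (htm n)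
  have hdj : Pairwise (Function.onFun Disjoint fun n => s ∩ t n) := fun i j hij =>
    (hdisj hij).mono inter_subset_right inter_subset_right
  have hU : s = ⋃ n, s ∩ t n := by rw [← inter_iUnion, inter_eq_left.2 hst]
  have hI : ∫⁻ y in s, ENNReal.ofReal (graphJacobian (fderiv ℝ φ y))
      = ∑' n, ∫⁻ y in s ∩ t n, ENNReal.ofReal (graphJacobian (fderiv ℝ φ y)) := by
    conv_lhs => rw [hU]
    exact lintegral_iUnion hm hdj _
  have hH : μHE[d] (ψ '' s) = ∑' n, μHE[d] (ψ '' (s ∩ t n)) := by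
    conv_lhs => rw [hU]
    rw [image_iUnion]
    refine measure_iUnion (fun i j hij => ?_) fun n =>
      (hψ.isClosedEmbedding hφ).measurableEmbedding.measurableSet_image' (hm n)
    exact disjoint_image_of_injective hψ.injective (hdj hij)
  have hae : ∀ n, ∀ᵐ y ∂volume.restrict (s ∩ t n), ‖fderiv ℝ φ y - A n‖ ≤ δ := fun n =>
    ae_norm_fderiv_sub_le_of_approximatesLinearOn (hm n) (happ n) fun y hy => hd y hy.1
  have hc : ENNReal.ofReal (1 + δ : ℝ) = ((1 + δ : ℝ≥0) : ℝ≥0∞) := by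
    rw [← ENNReal.ofReal_coe_nnreal]
    simp
  have hδ' : (0 : ℝ) ≤ 1 + δ := by positivity
  have hup : ∀ n, ENNReal.ofReal (graphJacobian (A n)) * volume (s ∩ t n)
      ≤ (1 + δ : ℝ≥0) * ∫⁻ y in s ∩ t n, ENNReal.ofReal (graphJacobian (fderiv ℝ φ y)) := by
    intro n
    rw [← setLIntegral_const, ← lintegral_const_mul _
      (measurable_graphJacobian_fderiv φ).ennreal_ofReal]
    refine lintegral_mono_ae ?_
    filter_upwards [hae n] with y hy
    rw [← hc, ← ENNReal.ofReal_mul hδ']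
    exact ENNReal.ofReal_le_ofReal (graphJacobian_le_mul (by rwa [norm_sub_rev]))
  have hlo : ∀ n, ∫⁻ y in s ∩ t n, ENNReal.ofReal (graphJacobian (fderiv ℝ φ y))
      ≤ (1 + δ : ℝ≥0) * (ENNReal.ofReal (graphJacobian (A n)) * volume (s ∩ t n)) := by
    intro n
    rw [← setLIntegral_const, ← lintegral_const_mul _ measurable_const]
    refine lintegral_mono_ae ?_
    filter_upwards [hae n] with y hy
    rw [← hc, ← ENNReal.ofReal_mul hδ']
    exact ENNReal.ofReal_le_ofReal (graphJacobian_le_mul hy)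
  rw [hI, hH, ← ENNReal.tsum_mul_left, ← ENNReal.tsum_mul_left]
  constructor
  · refine ENNReal.tsum_le_tsum fun n => ?_
    refine (hψ.measure_image_of_approximatesLinearOn (happ n)).1.trans ?_
    rw [pow_succ, mul_assoc]
    exact mul_le_mul_right (hup n) _
  · refine ENNReal.tsum_le_tsum fun n => ?_
    refine (hlo n).trans ?_
    rw [pow_succ', mul_assoc]
    exact mul_le_mul_right (hψ.measure_image_of_approximatesLinearOn (happ n)).2 _

/-- The area formula for the graph of a Lipschitz function. -/
theorem IsGraphMap.measure_image (hψ : IsGraphMap φ ψ) {L : ℝ≥0} (hφ : LipschitzWith L φ)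
    {s : Set (EuclideanSpace ℝ (Fin d))} (hs : MeasurableSet s) :
    μHE[d] (ψ '' s) = ∫⁻ y in s, ENNReal.ofReal (graphJacobian (fderiv ℝ φ y)) := by
  set D : Set (EuclideanSpace ℝ (Fin d)) := {y | DifferentiableAt ℝ φ y} with hD
  have hDm : MeasurableSet D := measurableSet_of_differentiableAt ℝ φ
  have hDc : volume Dᶜ = 0 := hφ.ae_differentiableAt
  -- by Rademacher's theorem, only the points of differentiability matter
  have hN : μHE[d] (ψ '' (s \ D)) = 0 := by
    have h := euclideanHausdorffMeasure_image_le_of_edist_le d (f := id) (g := ψ) (s := s \ D)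
      (K := 1 + L) fun a _ b _ => hψ.lipschitzWith hφ a b
    rw [image_id, EuclideanSpace.euclideanHausdorffMeasure_eq_volume,
      measure_mono_null (fun y hy => hy.2) hDc, mul_zero] at h
    exact le_antisymm h zero_le
  have h1 : μHE[d] (ψ '' s) = μHE[d] (ψ '' (s ∩ D)) := by
    refine le_antisymm ?_ (measure_mono (image_mono inter_subset_left))
    rw [← inter_union_sdiff s D, image_union, inter_union_sdiff s D]
    exact (measure_union_le _ _).trans (by rw [hN, add_zero])
  have h2 : ∫⁻ y in s, ENNReal.ofReal (graphJacobian (fderiv ℝ φ y))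
      = ∫⁻ y in s ∩ D, ENNReal.ofReal (graphJacobian (fderiv ℝ φ y)) := by
    refine setLIntegral_congr ?_
    refine (inter_ae_eq_left_of_ae_eq_univ ?_).symm
    exact ae_eq_univ.2 hDc
  rw [h1, h2]
  have key := fun (δ : ℝ≥0) (hδ : 0 < δ) =>
    hψ.measure_image_le_of_differentiableAt hφ (hs.inter hDm) (fun y hy => hy.2) hδ
  have lim : ∀ a : ℝ≥0∞, Tendsto (fun δ : ℝ≥0 => ((1 + δ : ℝ≥0) : ℝ≥0∞) ^ (d + 1) * a)
      (𝓝[>] 0) (𝓝 a) := by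
    intro a
    have hc : Tendsto (fun δ : ℝ≥0 => (((1 + δ) ^ (d + 1) : ℝ≥0) : ℝ≥0∞)) (𝓝[>] 0) (𝓝 1) := by
      have : Continuous fun δ : ℝ≥0 => (((1 + δ) ^ (d + 1) : ℝ≥0) : ℝ≥0∞) := by fun_prop
      simpa using (this.tendsto 0).mono_left nhdsWithin_le_nhds
    simpa using ENNReal.Tendsto.mul_const hc (Or.inl one_ne_zero)
  refine le_antisymm (ge_of_tendsto (lim _) ?_) (ge_of_tendsto (lim _) ?_)
  · filter_upwards [self_mem_nhdsWithin] with δ hδ using (key δ hδ).1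
  · filter_upwards [self_mem_nhdsWithin] with δ hδ using (key δ hδ).2

/-- The surface measure on the graph of a Lipschitz function, in the parametrization by the graph
map. -/
theorem IsGraphMap.restrict_range_eq_map (hψ : IsGraphMap φ ψ) {L : ℝ≥0}
    (hφ : LipschitzWith L φ) :
    (μHE[d] : Measure X).restrict (range ψ) = (volume.withDensity fun y =>
      ENNReal.ofReal (graphJacobian (fderiv ℝ φ y))).map ψ := by
  have hemb := (hψ.isClosedEmbedding hφ).measurableEmbedding
  ext s hs
  rw [Measure.restrict_apply hs, hemb.map_apply, withDensity_apply _ (hemb.measurable hs),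
    ← hψ.measure_image hφ (hemb.measurable hs), image_preimage_eq_inter_range]

end AreaFormula

/-! ### Integration by parts below a Lipschitz graph -/

section Subgraph

theorem exists_contDiff_cutoff {E : Type*} [NormedAddCommGroup E] [NormedSpace ℝ E]
    [FiniteDimensional ℝ E] {C U : Set E} (hC : IsCompact C) (hU : IsOpen U) (h : C ⊆ U) :
    ∃ (χ : E → ℝ) (K : Set E), ContDiff ℝ 1 χ ∧ IsCompact K ∧ K ⊆ U ∧ (∀ x ∈ C, χ x = 1) ∧
      ∀ x ∉ K, χ x = 0 := by
  obtain ⟨K, hK, hCK, hKU⟩ := exists_compact_between hC hU h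
  obtain ⟨f, h1, h0, -⟩ := exists_contMDiffMap_one_nhds_of_subset_interior (n := 1)
    (modelWithCornersSelf ℝ E) hC.isClosed hCK
  exact ⟨f, K, f.contMDiff.contDiff, hK, hKU, fun x hx => h1.self_of_nhdsSet x hx, h0⟩

/-- A function of class `C¹` on an open set that is multiplied by a cutoff function of that set is
of class `C¹` everywhere. -/
theorem contDiff_mul_cutoff {E : Type*} [NormedAddCommGroup E] [NormedSpace ℝ E] {U K : Set E}
    {g χ : E → ℝ} (hU : IsOpen U) (hg : ContDiffOn ℝ 1 g U) (hχ : ContDiff ℝ 1 χ)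
    (hK : IsClosed K) (hKU : K ⊆ U) (h0 : ∀ x ∉ K, χ x = 0) :
    ContDiff ℝ 1 fun x => g x * χ x := by
  refine contDiff_iff_contDiffAt.2 fun x => ?_
  by_cases hx : x ∈ K
  · exact (hg.contDiffAt (hU.mem_nhds (hKU hx))).mul hχ.contDiffAt
  · refine (contDiffAt_const (c := (0 : ℝ))).congr_of_eventuallyEq ?_
    filter_upwards [hK.isOpen_compl.mem_nhds hx] with y hy
    rw [h0 y hy, mul_zero]

theorem integral_lineDeriv_eq_zero {E : Type*} [NormedAddCommGroup E] [NormedSpace ℝ E]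
    [FiniteDimensional ℝ E] [MeasurableSpace E] [BorelSpace E] {μ : Measure E}
    [μ.IsAddHaarMeasure] {f : E → ℝ} {C : ℝ≥0} (hf : LipschitzWith C f)
    (hs : HasCompactSupport f) (v : E) : ∫ x, lineDeriv ℝ f x v ∂μ = 0 := by
  have h := (LipschitzWith.const (1 : ℝ)).integral_lineDeriv_mul_eq (μ := μ) hf hs (-v)
  have h1 : ∀ x : E, lineDeriv ℝ (fun _ : E => (1 : ℝ)) x (-v) = 0 := fun x => by
    simp [lineDeriv]
  simp only [h1, zero_mul, integral_zero, neg_neg, mul_one] at h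
  exact h.symm

variable {d : ℕ} {φ : EuclideanSpace ℝ (Fin d) → ℝ} {L : ℝ≥0}
  {g : EuclideanSpace ℝ (Fin d) × ℝ → ℝ} {K : Set (EuclideanSpace ℝ (Fin d) × ℝ)}

/-- The shear that maps the half space `{r < 0}` to the region below the graph of `φ`. -/
noncomputable def shear (φ : EuclideanSpace ℝ (Fin d) → ℝ) (hφ : Continuous φ) :
    EuclideanSpace ℝ (Fin d) × ℝ ≃ₜ EuclideanSpace ℝ (Fin d) × ℝ where
  toFun p := (p.1, φ p.1 + p.2)
  invFun p := (p.1, p.2 - φ p.1)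
  left_inv p := by simp
  right_inv p := by simp
  continuous_toFun := by fun_prop
  continuous_invFun := by fun_prop

theorem measurePreserving_shear (hφ : Continuous φ) :
    MeasurePreserving (shear φ hφ) volume volume :=
  MeasurePreserving.skew_product (g := fun x r => φ x + r) (MeasurePreserving.id _)
    (by fun_prop) (Eventually.of_forall fun x => (measurePreserving_add_left volume (φ x)).map_eq)

theorem isOpen_subgraph (hφ : Continuous φ) :
    IsOpen {z : EuclideanSpace ℝ (Fin d) × ℝ | z.2 < φ z.1} :=
  isOpen_lt (by fun_prop) (by fun_prop)

/-- On a graph parallel to that of `φ` and strictly below it, the tangential derivative of a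
compactly supported function has integral zero. -/
theorem integral_fderiv_tangent_eq_zero (hφ : LipschitzWith L φ)
    (hgd : ContDiffOn ℝ 1 g {z | z.2 < φ z.1}) (hK : IsCompact K) (hgK : ∀ z ∉ K, g z = 0)
    {r : ℝ} (hr : r < 0) (a : EuclideanSpace ℝ (Fin d)) :
    ∫ y, fderiv ℝ g (y, φ y + r) (a, fderiv ℝ φ y a) = 0 := by
  have hU := isOpen_subgraph hφ.continuous
  set U := {z : EuclideanSpace ℝ (Fin d) × ℝ | z.2 < φ z.1} with hUdef
  have hφc := hφ.continuous
  -- a cutoff that is one on the part of the support on the parallel graph makes `g` Lipschitz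
  set C := K ∩ {z | z.2 = φ z.1 + r} with hC
  have hCc : IsCompact C := hK.inter_right (isClosed_eq (by fun_prop) (by fun_prop))
  have hCU : C ⊆ U := fun z hz => by
    have : z.2 = φ z.1 + r := hz.2
    change z.2 < φ z.1
    linarith
  obtain ⟨χ, K', hχ, hK', hKU, h1, h0⟩ := exists_contDiff_cutoff hCc hU hCU
  have hsm := contDiff_mul_cutoff hU hgd hχ hK'.isClosed hKU h0
  have hsupp : HasCompactSupport fun z => g z * χ z :=
    HasCompactSupport.intro hK' fun z hz => by rw [h0 z hz, mul_zero]
  obtain ⟨D, hD⟩ := hsm.lipschitzWith_of_hasCompactSupport hsupp one_ne_zero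
  set H : EuclideanSpace ℝ (Fin d) → ℝ := fun y => g (y, φ y + r) with hH
  have hHeq : H = (fun z => g z * χ z) ∘ fun y => (y, φ y + r) := by
    funext y
    by_cases hy : (y, φ y + r) ∈ K
    · simp [hH, h1 (y, φ y + r) ⟨hy, rfl⟩]
    · simp [hH, hgK _ hy]
  have hHL : ∃ C', LipschitzWith C' H := by
    rw [hHeq]
    exact ⟨_, hD.comp (LipschitzWith.id.prodMk (hφ.add (LipschitzWith.const r)))⟩
  have hHs : HasCompactSupport H :=
    HasCompactSupport.intro (hK.image continuous_fst) fun y hy =>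
      hgK _ fun hm => hy ⟨_, hm, rfl⟩
  obtain ⟨C', hC'⟩ := hHL
  rw [← integral_lineDeriv_eq_zero (μ := volume) hC' hHs a]
  refine integral_congr_ae ?_
  filter_upwards [hφ.ae_differentiableAt (μ := volume)] with y hy
  have hyU : (y, φ y + r) ∈ U := by
    change φ y + r < φ y
    linarith
  have hg : HasFDerivAt g (fderiv ℝ g (y, φ y + r)) (y, φ y + r) :=
    ((hgd.contDiffAt (hU.mem_nhds hyU)).differentiableAt one_ne_zero).hasFDerivAt
  have hp : HasFDerivAt (fun y => (y, φ y + r))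
      ((ContinuousLinearMap.id ℝ _).prod (fderiv ℝ φ y)) y :=
    (hasFDerivAt_id y).prodMk (hy.hasFDerivAt.add_const r)
  have := (hg.comp y hp).hasLineDerivAt a
  exact this.lineDeriv.symm

/-- The fundamental theorem of calculus on a vertical ray below the graph. -/
theorem integral_vertical_eq (hgc : ContinuousOn g {z | z.2 ≤ φ z.1})
    (hφ : Continuous φ)
    (hgd : ContDiffOn ℝ 1 g {z | z.2 < φ z.1}) (hK : IsCompact K) (hgK : ∀ z ∉ K, g z = 0)
    (y : EuclideanSpace ℝ (Fin d))
    (hi : IntegrableOn (fun r => fderiv ℝ g (y, φ y + r) (0, 1)) (Iio 0)) :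
    ∫ r in Iio (0 : ℝ), fderiv ℝ g (y, φ y + r) (0, 1) = g (y, φ y) := by
  have hU := isOpen_subgraph hφ
  have hder : ∀ r ∈ Iio (0 : ℝ), HasDerivAt (fun r => g (y, φ y + r))
      (fderiv ℝ g (y, φ y + r) (0, 1)) r := by
    intro r hr
    have hyU : (y, φ y + r) ∈ {z : EuclideanSpace ℝ (Fin d) × ℝ | z.2 < φ z.1} := by
      have : r < 0 := hr
      change φ y + r < φ y
      linarith
    have hg : HasFDerivAt g (fderiv ℝ g (y, φ y + r)) (y, φ y + r) :=
      ((hgd.contDiffAt (hU.mem_nhds hyU)).differentiableAt one_ne_zero).hasFDerivAt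
    exact hg.comp_hasDerivAt r ((hasDerivAt_const r y).prodMk ((hasDerivAt_id r).const_add (φ y)))
  have hcont : ContinuousWithinAt (fun r => g (y, φ y + r)) (Iic 0) 0 := by
    have h0 : (y, φ y + 0) ∈ {z : EuclideanSpace ℝ (Fin d) × ℝ | z.2 ≤ φ z.1} := by simp
    refine ContinuousWithinAt.comp (hgc _ h0) (by fun_prop) fun r hr => ?_
    have : r ≤ 0 := hr
    change φ y + r ≤ φ y
    linarith
  have hlim : Tendsto (fun r => g (y, φ y + r)) atBot (𝓝 0) := by
    obtain ⟨R, hR⟩ := (hK.image continuous_snd).bddBelow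
    refine tendsto_const_nhds.congr' ?_
    filter_upwards [eventually_lt_atBot (R - φ y)] with r hr
    refine (hgK _ fun hm => ?_).symm
    have := hR ⟨_, hm, rfl⟩
    simp only at this
    linarith
  rw [← integral_Iic_eq_integral_Iio]
  rw [integral_Iic_of_hasDerivAt_of_tendsto hcont hder
    ((integrableOn_Iic_iff_integrableOn_Iio (by finiteness)).2 hi) hlim, sub_zero, add_zero]

/-- The divergence theorem below the graph of a Lipschitz function: the vector `(-∇φ, 1)` is the
outward normal times the Jacobian of the graph. -/
theorem integral_fderiv_subgraph (hφ : LipschitzWith L φ)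
    (hgc : ContinuousOn g {z | z.2 ≤ φ z.1}) (hgd : ContDiffOn ℝ 1 g {z | z.2 < φ z.1})
    {M : ℝ} (hM : ∀ z, z.2 < φ z.1 → ‖fderiv ℝ g z‖ ≤ M) (hK : IsCompact K)
    (hgK : ∀ z ∉ K, g z = 0) (a : EuclideanSpace ℝ (Fin d)) (b : ℝ) :
    IntegrableOn (fun z => fderiv ℝ g z (a, b)) {z | z.2 < φ z.1} ∧
    ∫ z in {z | z.2 < φ z.1}, fderiv ℝ g z (a, b)
      = ∫ y, g (y, φ y) * (b - fderiv ℝ φ y a) := by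
  have hφc := hφ.continuous
  have hzero : ∀ z ∉ K, fderiv ℝ g z = 0 := by
    intro z hz
    have : g =ᶠ[𝓝 z] fun _ => 0 := by
      filter_upwards [hK.isClosed.isOpen_compl.mem_nhds hz] with y hy using hgK y hy
    rw [this.fderiv_eq]
    simp
  set T := shear φ hφc with hT
  have hTp : MeasurePreserving T volume volume := measurePreserving_shear hφc
  have hTe : MeasurableEmbedding T := T.measurableEmbedding
  have hpre : T ⁻¹' {z | z.2 < φ z.1} = univ ×ˢ Iio (0 : ℝ) := by
    ext p
    simp [hT, shear]
  have hUm := (isOpen_subgraph hφc).measurableSet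
  -- every directional derivative is bounded, and vanishes off a compact set
  have hint : ∀ w, IntegrableOn (fun z => fderiv ℝ g z w) {z | z.2 < φ z.1} := by
    intro w
    have h1 : IntegrableOn (fun z => fderiv ℝ g z w) ({z | z.2 < φ z.1} ∩ K) := by
      refine Measure.integrableOn_of_bounded (M := M * ‖w‖)
        (measure_ne_top_of_subset inter_subset_right hK.measure_lt_top.ne)
        (measurable_fderiv_apply_const ℝ g w).aestronglyMeasurable ?_
      filter_upwards [ae_restrict_mem (hUm.inter hK.measurableSet)] with z hz
      exact (ContinuousLinearMap.le_opNorm _ _).trans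
        (mul_le_mul_of_nonneg_right (hM z hz.1) (norm_nonneg _))
    refine h1.of_forall_sdiff_eq_zero hUm fun z hz => ?_
    rw [hzero z fun hk => hz.2 ⟨hz.1, hk⟩]
    simp
  have hvol : (volume : Measure (EuclideanSpace ℝ (Fin d) × ℝ)).restrict (univ ×ˢ Iio (0 : ℝ))
      = (volume : Measure (EuclideanSpace ℝ (Fin d))).prod (volume.restrict (Iio (0 : ℝ))) := by
    rw [Measure.volume_eq_prod, ← Measure.prod_restrict, Measure.restrict_univ]
  have hintT : ∀ w, Integrable (fun p => fderiv ℝ g (T p) w)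
      ((volume : Measure (EuclideanSpace ℝ (Fin d))).prod (volume.restrict (Iio (0 : ℝ)))) := by
    intro w
    rw [← hvol, ← hpre]
    exact (hTp.integrableOn_comp_preimage hTe).2 (hint w)
  refine ⟨hint _, ?_⟩
  set c : EuclideanSpace ℝ (Fin d) → ℝ := fun y => b - fderiv ℝ φ y a with hc
  have hcm : Measurable c := measurable_const.sub (measurable_fderiv_apply_const ℝ φ a)
  have hcb : ∀ y, ‖c y‖ ≤ |b| + L * ‖a‖ := by
    intro y
    refine (norm_sub_le _ _).trans (add_le_add le_rfl ?_)
    exact (ContinuousLinearMap.le_opNorm _ _).trans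
      (mul_le_mul_of_nonneg_right (norm_fderiv_le_of_lipschitz ℝ hφ) (norm_nonneg _))
  have hi2 : Integrable (fun p : EuclideanSpace ℝ (Fin d) × ℝ =>
      c p.1 * fderiv ℝ g (T p) (0, 1))
      ((volume : Measure (EuclideanSpace ℝ (Fin d))).prod (volume.restrict (Iio (0 : ℝ)))) :=
    (hintT (0, 1)).bdd_mul (hcm.comp measurable_fst).aestronglyMeasurable
      (Eventually.of_forall fun p => hcb p.1)
  -- split the direction into a tangential and a vertical part
  have hsplit : ∀ p : EuclideanSpace ℝ (Fin d) × ℝ, fderiv ℝ g (T p) (a, b)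
      = fderiv ℝ g (T p) (a, fderiv ℝ φ p.1 a) + c p.1 * fderiv ℝ g (T p) (0, 1) := by
    intro p
    rw [← smul_eq_mul (c p.1), ← map_smul, ← map_add]
    simp [hc]
  have hi1 : Integrable (fun p : EuclideanSpace ℝ (Fin d) × ℝ =>
      fderiv ℝ g (T p) (a, fderiv ℝ φ p.1 a))
      ((volume : Measure (EuclideanSpace ℝ (Fin d))).prod (volume.restrict (Iio (0 : ℝ)))) := by
    refine ((hintT (a, b)).sub hi2).congr (Eventually.of_forall fun p => ?_)
    simp only [Pi.sub_apply]
    rw [hsplit p]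
    ring
  rw [← hTp.setIntegral_preimage_emb hTe, hpre, hvol]
  simp_rw [hsplit]
  rw [integral_add hi1 hi2, integral_prod_symm _ hi1, integral_prod _ hi2]
  have hz1 : ∫ r in Iio (0 : ℝ), ∫ y, fderiv ℝ g (T (y, r)) (a, fderiv ℝ φ y a) = 0 := by
    refine setIntegral_eq_zero_of_forall_eq_zero fun r hr => ?_
    exact integral_fderiv_tangent_eq_zero hφ hgd hK hgK hr a
  rw [hz1, zero_add]
  refine integral_congr_ae ?_
  filter_upwards [(hintT (0, 1)).prod_right_ae] with y hy
  rw [integral_const_mul, mul_comm]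
  congr 1
  exact integral_vertical_eq hgc hφc hgd hK hgK y hy

end Subgraph

/-! ### Lipschitz domains in graph coordinates -/

section Chart

/-- The space of the coordinates `(y, s)`, where `s` is the height over the plane of `y`. -/
abbrev GraphCoord := EuclideanSpace ℝ (Fin 2) × ℝ

/-- The parametrization of space by the Cartesian coordinates of the orthonormal basis `b`, the
last coordinate being the height. -/
noncomputable def chart (b : OrthonormalBasis (Fin 3) ℝ Space) : GraphCoord ≃L[ℝ] Space :=
  LinearEquiv.toContinuousLinearEquiv
    { toFun := fun z => b.repr.symm !₂[z.1 0, z.1 1, z.2]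
      invFun := fun x => (!₂[b.repr x 0, b.repr x 1], b.repr x 2)
      map_add' := fun z z' => by
        rw [← map_add]
        congr 1
        ext i
        fin_cases i <;> simp
      map_smul' := fun r z => by
        rw [RingHom.id_apply, ← map_smul]
        congr 1
        ext i
        fin_cases i <;> simp
      left_inv := fun z => by
        ext i
        · fin_cases i <;> simp
        · simp
      right_inv := fun x => by
        rw [LinearIsometryEquiv.symm_apply_eq]
        ext i
        fin_cases i <;> simp }

variable (b : OrthonormalBasis (Fin 3) ℝ Space)

theorem chart_apply (z : GraphCoord) : chart b z = b.repr.symm !₂[z.1 0, z.1 1, z.2] := rfl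

theorem chart_symm_apply (x : Space) :
    (chart b).symm x = (!₂[b.repr x 0, b.repr x 1], b.repr x 2) := rfl

theorem inner_chart (z w : GraphCoord) :
    inner ℝ (chart b z) (chart b w) = inner ℝ z.1 w.1 + z.2 * w.2 := by
  rw [chart_apply, chart_apply, LinearIsometryEquiv.inner_map_map]
  simp only [PiLp.inner_apply, Fin.sum_univ_three, Fin.sum_univ_two]
  simp
  ring

theorem norm_chart_sq (z : GraphCoord) : ‖chart b z‖ ^ 2 = ‖z.1‖ ^ 2 + z.2 ^ 2 := by
  rw [← real_inner_self_eq_norm_sq, inner_chart, real_inner_self_eq_norm_sq, sq z.2]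

theorem norm_fst_le_norm_chart (z : GraphCoord) : ‖z.1‖ ≤ ‖chart b z‖ :=
  abs_le_of_sq_le_sq' (by rw [norm_chart_sq]; nlinarith [sq_nonneg z.2]) (norm_nonneg _) |>.2

theorem measurePreserving_chart : MeasurePreserving (chart b) volume volume := by
  have h1 : MeasurePreserving (Prod.map (WithLp.ofLp : EuclideanSpace ℝ (Fin 2) → _) (id : ℝ → ℝ))
      volume volume := (PiLp.volume_preserving_ofLp (Fin 2)).prod (MeasurePreserving.id _)
  have h2 : MeasurePreserving (Prod.swap : (Fin 2 → ℝ) × ℝ → ℝ × (Fin 2 → ℝ)) volume volume :=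
    Measure.measurePreserving_swap
  have h3 := (volume_preserving_piFinSuccAbove (fun _ : Fin 3 => ℝ) 2).symm
  have h4 := PiLp.volume_preserving_toLp (Fin 3)
  have h5 := b.measurePreserving_repr_symm
  have h := h5.comp (h4.comp (h3.comp (h2.comp h1)))
  convert h using 1
  funext z
  rw [chart_apply]
  simp only [Function.comp_apply]
  congr 1
  ext i
  fin_cases i
  · simp [MeasurableEquiv.piFinSuccAbove, Fin.insertNthEquiv]
    rfl
  · simp [MeasurableEquiv.piFinSuccAbove, Fin.insertNthEquiv]
    rfl
  · simp [MeasurableEquiv.piFinSuccAbove, Fin.insertNthEquiv]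

/-- In the open set `V`, the set `Ω` is the region strictly below the graph of the Lipschitz
function `φ` in the Cartesian coordinates of `b`. -/
structure IsGraphChart (Ω : Set Space) (b : OrthonormalBasis (Fin 3) ℝ Space)
    (φ : EuclideanSpace ℝ (Fin 2) → ℝ) (L : ℝ≥0) (V : Set Space) : Prop where
  lipschitzWith : LipschitzWith L φ
  isOpen : IsOpen V
  mem_iff : ∀ z, chart b z ∈ V → (chart b z ∈ Ω ↔ z.2 < φ z.1)

theorem IsBoundedLipschitzDomain.exists_isGraphChart {Ω : Set Space}
    (hΩ : IsBoundedLipschitzDomain Ω) {x : Space} (hx : x ∈ frontier Ω) :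
    ∃ b φ L V, x ∈ V ∧ IsGraphChart Ω b φ L V := by
  obtain ⟨b, φ, L, hφ, hV⟩ := hΩ.exists_graph x hx
  obtain ⟨V, hV, hVo, hxV⟩ := eventually_nhds_iff.1 hV
  refine ⟨b, φ, L, V, hxV, hφ, hVo, fun z hz => ?_⟩
  have h := hV _ hz
  have hz' := (chart b).symm_apply_apply z
  rw [chart_symm_apply] at hz'
  have h1 : b.repr (chart b z) 2 = z.2 := congrArg Prod.snd hz'
  have h2 : !₂[b.repr (chart b z) 0, b.repr (chart b z) 1] = z.1 := congrArg Prod.fst hz'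
  rw [h, h1, h2]

/-- The parametrization of the graph of `φ`. -/
noncomputable def graphMap (b : OrthonormalBasis (Fin 3) ℝ Space)
    (φ : EuclideanSpace ℝ (Fin 2) → ℝ) (y : EuclideanSpace ℝ (Fin 2)) : Space :=
  chart b (y, φ y)

theorem isGraphMap_graphMap (φ : EuclideanSpace ℝ (Fin 2) → ℝ) :
    IsGraphMap φ (graphMap b φ) := fun y z => by
  rw [dist_eq_norm, graphMap, graphMap, ← map_sub, norm_chart_sq, dist_eq_norm]
  rfl

theorem closure_subgraph {φ : EuclideanSpace ℝ (Fin 2) → ℝ} (hφ : Continuous φ) :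
    closure {z : GraphCoord | z.2 < φ z.1} = {z | z.2 ≤ φ z.1} := by
  refine subset_antisymm (closure_lt_subset_le (by fun_prop) (by fun_prop)) fun z hz => ?_
  have hz' : z.2 ≤ φ z.1 := hz
  have hlim : Tendsto (fun r : ℝ => (z.1, z.2 - r)) (𝓝[>] 0) (𝓝 z) := by
    have : Continuous fun r : ℝ => (z.1, z.2 - r) := by fun_prop
    simpa using (this.tendsto 0).mono_left nhdsWithin_le_nhds
  refine mem_closure_of_tendsto hlim ?_
  filter_upwards [self_mem_nhdsWithin] with r hr
  have : (0 : ℝ) < r := hr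
  change z.2 - r < φ z.1
  linarith

namespace IsGraphChart

variable {b} {Ω V : Set Space} {φ : EuclideanSpace ℝ (Fin 2) → ℝ} {L : ℝ≥0}

theorem isOpen_preimage (h : IsGraphChart Ω b φ L V) : IsOpen (chart b ⁻¹' V) :=
  h.isOpen.preimage (chart b).continuous

theorem mem_closure_iff (h : IsGraphChart Ω b φ L V) {z : GraphCoord}
    (hz : chart b z ∈ V) : chart b z ∈ closure Ω ↔ z.2 ≤ φ z.1 := by
  have h1 : chart b ⁻¹' closure Ω = closure (chart b ⁻¹' Ω) :=
    (chart b).toHomeomorph.preimage_closure Ω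
  have h2 : z ∈ closure {z : GraphCoord | z.2 < φ z.1} ↔ z.2 ≤ φ z.1 := by
    rw [closure_subgraph h.lipschitzWith.continuous]
    rfl
  rw [← h2, ← mem_preimage, h1, mem_closure_iff_frequently, mem_closure_iff_frequently]
  refine frequently_congr ?_
  filter_upwards [h.isOpen_preimage.mem_nhds hz] with w hw using h.mem_iff w hw

theorem mem_frontier_iff (h : IsGraphChart Ω b φ L V) (hΩ : IsOpen Ω) {z : GraphCoord}
    (hz : chart b z ∈ V) : chart b z ∈ frontier Ω ↔ z.2 = φ z.1 := by
  rw [hΩ.frontier_eq, Set.mem_sdiff, h.mem_closure_iff hz, h.mem_iff z hz, not_lt]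
  exact ⟨fun h => le_antisymm h.1 h.2, fun h => ⟨h.le, h.ge⟩⟩

theorem frontier_inter_eq (h : IsGraphChart Ω b φ L V) (hΩ : IsOpen Ω) :
    V ∩ frontier Ω = V ∩ range (graphMap b φ) := by
  ext x
  obtain ⟨z, rfl⟩ := (chart b).surjective x
  refine and_congr_right fun hz => ?_
  rw [h.mem_frontier_iff hΩ hz]
  constructor
  · intro hz
    exact ⟨z.1, by rw [graphMap, ← hz]⟩
  · rintro ⟨y, hy⟩
    rw [← (chart b).injective hy]

/-- A point of a Lipschitz graph is the vertex of an open convex cone below the graph. -/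
theorem uniqueDiffWithinAt (h : IsGraphChart Ω b φ L V) {y : EuclideanSpace ℝ (Fin 2)}
    (hy : graphMap b φ y ∈ V) : UniqueDiffWithinAt ℝ (closure Ω) (graphMap b φ y) := by
  set T := (chart b).symm with hT
  set C : Set Space := {x | (T x).2 + L * ‖(T x).1 - y‖ < φ y} with hC
  have hopen : IsOpen C := isOpen_lt (by fun_prop) (by fun_prop)
  have hconv : Convex ℝ C := by
    intro p hp q hq r s hr hs hrs
    have hp' : (T p).2 + L * ‖(T p).1 - y‖ < φ y := hp
    have hq' : (T q).2 + L * ‖(T q).1 - y‖ < φ y := hq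
    change (T (r • p + s • q)).2 + L * ‖(T (r • p + s • q)).1 - y‖ < φ y
    have e : (T (r • p + s • q)).1 - y = r • ((T p).1 - y) + s • ((T q).1 - y) := by
      rw [map_add, map_smul, map_smul]
      have : y = (r + s) • y := by rw [hrs, one_smul]
      nth_rewrite 1 [this]
      simp only [Prod.fst_add, Prod.smul_fst]
      module
    have e2 : (T (r • p + s • q)).2 = r * (T p).2 + s * (T q).2 := by
      rw [map_add, map_smul, map_smul]
      simp
    have n : ‖(T (r • p + s • q)).1 - y‖ ≤ r * ‖(T p).1 - y‖ + s * ‖(T q).1 - y‖ := by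
      rw [e]
      refine (norm_add_le _ _).trans ?_
      rw [norm_smul, norm_smul, Real.norm_of_nonneg hr, Real.norm_of_nonneg hs]
    have n' := mul_le_mul_of_nonneg_left n L.coe_nonneg
    rw [e2]
    have hφy : φ y = r * φ y + s * φ y := by rw [← add_mul, hrs, one_mul]
    rcases hr.eq_or_lt with rfl | hr'
    · have hs1 : s = 1 := by linarith
      subst hs1
      linarith
    · nlinarith [mul_lt_mul_of_pos_left hp' hr', mul_le_mul_of_nonneg_left hq'.le hs]
  have hlim : Tendsto (fun r : ℝ => chart b (y, φ y - r)) (𝓝[>] 0) (𝓝 (graphMap b φ y)) := by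
    have : Continuous fun r : ℝ => chart b (y, φ y - r) := by fun_prop
    simpa [graphMap] using (this.tendsto 0).mono_left nhdsWithin_le_nhds
  have hmem : ∀ᶠ r : ℝ in 𝓝[>] 0, chart b (y, φ y - r) ∈ C := by
    filter_upwards [self_mem_nhdsWithin] with r hr
    have : (0 : ℝ) < r := hr
    change (T (chart b (y, φ y - r))).2 + L * ‖(T (chart b (y, φ y - r))).1 - y‖ < φ y
    rw [hT, (chart b).symm_apply_apply]
    simpa using this
  have hu := uniqueDiffWithinAt_convex hconv
    (by rw [hopen.interior_eq]; exact hmem.exists.imp' _ fun _ hr => hr)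
    (mem_closure_of_tendsto hlim hmem)
  refine (hu.inter (h.isOpen.mem_nhds hy)).mono fun x hx => subset_closure ?_
  obtain ⟨z, rfl⟩ := (chart b).surjective x
  have hz : (T (chart b z)).2 + L * ‖(T (chart b z)).1 - y‖ < φ y := hx.1
  rw [hT, (chart b).symm_apply_apply] at hz
  refine (h.mem_iff z hx.2).2 ?_
  have := h.lipschitzWith.dist_le_mul z.1 y
  rw [Real.dist_eq, dist_eq_norm] at this
  linarith [neg_le_of_abs_le this]

/-- The outward unit normal at a point where the graph has a tangent plane. -/
theorem outwardNormal_eq (h : IsGraphChart Ω b φ L V) {y : EuclideanSpace ℝ (Fin 2)}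
    (hy : graphMap b φ y ∈ V) (hd : DifferentiableAt ℝ φ y) :
    outwardNormal Ω (graphMap b φ y)
      = (graphJacobian (fderiv ℝ φ y))⁻¹ • chart b (-gradient φ y, 1) := by
  set J := graphJacobian (fderiv ℝ φ y) with hJ
  have hJ1 : 1 ≤ J := one_le_graphJacobian _
  have hJ0 : 0 < J := graphJacobian_pos _
  have hgrad : ∀ w, inner ℝ w (gradient φ y) = fderiv ℝ φ y w := fun w => by
    rw [real_inner_comm, gradient, InnerProductSpace.toDual_symm_apply]
  have hin : ∀ w : GraphCoord, inner ℝ (chart b w) (J⁻¹ • chart b (-gradient φ y, 1))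
      = J⁻¹ * (w.2 - fderiv ℝ φ y w.1) := fun w => by
    rw [real_inner_smul_right, inner_chart, inner_neg_right, hgrad]
    ring
  have hν : IsOutwardUnitNormal Ω (graphMap b φ y) (J⁻¹ • chart b (-gradient φ y, 1)) := by
    constructor
    · have hnorm : ‖chart b (-gradient φ y, 1)‖ = J := by
        rw [← sq_eq_sq₀ (norm_nonneg _) hJ0.le, norm_chart_sq, hJ, graphJacobian_sq, norm_neg,
          gradient, LinearIsometryEquiv.norm_map]
        ring
      rw [norm_smul, hnorm, norm_inv, Real.norm_of_nonneg hJ0.le, inv_mul_cancel₀ hJ0.ne']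
    · intro ε hε
      have hlin := hd.hasFDerivAt.isLittleO.def hε
      have hT : Tendsto (fun x => ((chart b).symm x).1) (𝓝 (graphMap b φ y)) (𝓝 y) := by
        have : Continuous fun x => ((chart b).symm x).1 := by fun_prop
        simpa [graphMap] using this.tendsto (graphMap b φ y)
      filter_upwards [hT.eventually hlin, h.isOpen.mem_nhds hy] with x hx hxV
      obtain ⟨z, rfl⟩ := (chart b).surjective x
      rw [(chart b).symm_apply_apply, Real.norm_eq_abs] at hx
      have hsub : chart b z - graphMap b φ y = chart b (z.1 - y, z.2 - φ y) := by
        rw [graphMap, ← map_sub]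
        rfl
      have hle : ‖z.1 - y‖ ≤ ‖chart b (z.1 - y, z.2 - φ y)‖ :=
        norm_fst_le_norm_chart b (z.1 - y, z.2 - φ y)
      rw [hsub, hin, h.mem_iff z hxV]
      set N := ‖chart b (z.1 - y, z.2 - φ y)‖
      have hεN : ε * ‖z.1 - y‖ ≤ ε * N := by gcongr
      have hεJ : ε * N ≤ J * (ε * N) := le_mul_of_one_le_left (by positivity) hJ1
      obtain ⟨hx1, hx2⟩ := abs_le.1 hx
      constructor
      · intro hlt
        have := mul_lt_mul_of_pos_left hlt hJ0
        rw [mul_inv_cancel_left₀ hJ0.ne'] at this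
        simp only at this
        nlinarith
      · intro hlt
        have := mul_lt_mul_of_pos_left hlt hJ0
        rw [mul_inv_cancel_left₀ hJ0.ne'] at this
        simp only at this
        nlinarith
  have hex : ∃ ν, IsOutwardUnitNormal Ω (graphMap b φ y) ν := ⟨_, hν⟩
  rw [outwardNormal, dif_pos hex]
  exact hex.choose_spec.unique hν

end IsGraphChart

theorem IsBoundedLipschitzDomain.uniqueDiffOn_closure {Ω : Set Space}
    (hΩ : IsBoundedLipschitzDomain Ω) : UniqueDiffOn ℝ (closure Ω) := by
  intro x hx
  by_cases hxΩ : x ∈ Ω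
  · exact (hΩ.isOpen.uniqueDiffWithinAt hxΩ).mono subset_closure
  have hf : x ∈ frontier Ω := by
    rw [hΩ.isOpen.frontier_eq]
    exact ⟨hx, hxΩ⟩
  obtain ⟨b, φ, L, V, hxV, h⟩ := hΩ.exists_isGraphChart hf
  obtain ⟨y, rfl⟩ := ((h.frontier_inter_eq hΩ.isOpen).subset ⟨hxV, hf⟩).2
  exact h.uniqueDiffWithinAt hxV

end Chart

/-! ### The divergence theorem on Lipschitz domains -/

section DivergenceTheorem

variable {Ω : Set Space}

theorem IsBoundedLipschitzDomain.isCompact_closure (hΩ : IsBoundedLipschitzDomain Ω) :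
    IsCompact (closure Ω) :=
  Metric.isCompact_of_isClosed_isBounded isClosed_closure hΩ.isBounded.closure

theorem IsBoundedLipschitzDomain.isCompact_frontier (hΩ : IsBoundedLipschitzDomain Ω) :
    IsCompact (frontier Ω) :=
  hΩ.isCompact_closure.of_isClosed_subset isClosed_frontier frontier_subset_closure

theorem IsBoundedLipschitzDomain.integrableOn (hΩ : IsBoundedLipschitzDomain Ω)
    {f : Space → ℝ} (hf : ContinuousOn f (closure Ω)) : IntegrableOn f Ω :=
  (hf.integrableOn_compact hΩ.isCompact_closure).mono_set subset_closure

theorem IsBoundedLipschitzDomain.integrableOn_fderivWithin (hΩ : IsBoundedLipschitzDomain Ω)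
    {G : Space → ℝ} (hG : ContDiffOn ℝ 1 G (closure Ω)) (v : Space) :
    IntegrableOn (fun x => fderivWithin ℝ G (closure Ω) x v) Ω :=
  hΩ.integrableOn ((hG.continuousOn_fderivWithin hΩ.uniqueDiffOn_closure le_rfl).clm_apply
    continuousOn_const)

theorem fderivWithin_closure_eq (hΩ : IsOpen Ω) {F : Type*} [NormedAddCommGroup F]
    [NormedSpace ℝ F] (G : Space → F) {x : Space} (hx : x ∈ Ω) :
    fderivWithin ℝ G (closure Ω) x = fderiv ℝ G x :=
  fderivWithin_of_mem_nhds (mem_of_superset (hΩ.mem_nhds hx) subset_closure)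

theorem norm_outwardNormal_le (Ω : Set Space) (x : Space) : ‖outwardNormal Ω x‖ ≤ 1 := by
  unfold outwardNormal
  split_ifs with h
  · exact h.choose_spec.1.le
  · simp

namespace IsGraphChart

variable {b : OrthonormalBasis (Fin 3) ℝ Space} {V : Set Space}
  {φ : EuclideanSpace ℝ (Fin 2) → ℝ} {L : ℝ≥0}

theorem isClosedEmbedding (h : IsGraphChart Ω b φ L V) : IsClosedEmbedding (graphMap b φ) :=
  (isGraphMap_graphMap b φ).isClosedEmbedding h.lipschitzWith

theorem measurableSet_preimage (h : IsGraphChart Ω b φ L V) :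
    MeasurableSet (graphMap b φ ⁻¹' V) :=
  (h.isOpen.preimage h.isClosedEmbedding.continuous).measurableSet

/-- The surface measure in graph coordinates. -/
theorem restrict_surfaceMeasure (h : IsGraphChart Ω b φ L V) (hΩ : IsOpen Ω) :
    (surfaceMeasure Ω).restrict V = ((volume.restrict (graphMap b φ ⁻¹' V)).withDensity fun y =>
      ENNReal.ofReal (graphJacobian (fderiv ℝ φ y))).map (graphMap b φ) := by
  have hemb := h.isClosedEmbedding.measurableEmbedding
  rw [surfaceMeasure, Measure.restrict_restrict h.isOpen.measurableSet,
    h.frontier_inter_eq hΩ, ← Measure.restrict_restrict h.isOpen.measurableSet,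
    (isGraphMap_graphMap b φ).restrict_range_eq_map h.lipschitzWith, hemb.restrict_map,
    restrict_withDensity h.measurableSet_preimage]

theorem ae_outwardNormal_eq (h : IsGraphChart Ω b φ L V) :
    ∀ᵐ y ∂(volume.restrict (graphMap b φ ⁻¹' V)), outwardNormal Ω (graphMap b φ y)
      = (graphJacobian (fderiv ℝ φ y))⁻¹ • chart b (-gradient φ y, 1) := by
  filter_upwards [ae_restrict_mem h.measurableSet_preimage,
    ae_restrict_of_ae h.lipschitzWith.ae_differentiableAt] with y hy hd
  exact h.outwardNormal_eq hy hd

theorem aestronglyMeasurable_outwardNormal (h : IsGraphChart Ω b φ L V) (hΩ : IsOpen Ω) :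
    AEStronglyMeasurable (outwardNormal Ω) ((surfaceMeasure Ω).restrict V) := by
  rw [h.restrict_surfaceMeasure hΩ,
    h.isClosedEmbedding.measurableEmbedding.aestronglyMeasurable_map_iff]
  have hm : Measurable fun y => (graphJacobian (fderiv ℝ φ y))⁻¹ • chart b (-gradient φ y, 1) := by
    have hg : Measurable (gradient φ) :=
      (InnerProductSpace.toDual ℝ _).symm.continuous.measurable.comp (measurable_fderiv ℝ φ)
    exact (measurable_graphJacobian_fderiv φ).inv.smul
      ((chart b).continuous.measurable.comp (hg.neg.prodMk measurable_const))
  refine hm.aestronglyMeasurable.congr ?_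
  filter_upwards [(withDensity_absolutelyContinuous _ _).ae_le h.ae_outwardNormal_eq] with y hy
    using hy.symm

theorem surfaceMeasure_lt_top (h : IsGraphChart Ω b φ L V) (hΩ : IsOpen Ω) {K : Set Space}
    (hK : IsCompact K) (hKV : K ⊆ V) : surfaceMeasure Ω K < ⊤ := by
  have hsub : K ∩ frontier Ω ⊆ graphMap b φ '' (graphMap b φ ⁻¹' K) := by
    rintro x ⟨hxK, hxf⟩
    obtain ⟨y, rfl⟩ := ((h.frontier_inter_eq hΩ).subset ⟨hKV hxK, hxf⟩).2
    exact ⟨y, hxK, rfl⟩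
  rw [surfaceMeasure, Measure.restrict_apply hK.measurableSet]
  refine (measure_mono hsub).trans_lt ?_
  have := euclideanHausdorffMeasure_image_le_of_edist_le 2 (f := id) (g := graphMap b φ)
    (s := graphMap b φ ⁻¹' K) (K := 1 + L) fun a _ b' _ =>
      (isGraphMap_graphMap b φ).lipschitzWith h.lipschitzWith a b'
  refine this.trans_lt (ENNReal.mul_lt_top (by finiteness) ?_)
  rw [image_id, EuclideanSpace.euclideanHausdorffMeasure_eq_volume]
  exact (h.isClosedEmbedding.isCompact_preimage hK).measure_lt_top

/-- The divergence theorem for a function supported in a graph chart, in the direction `v`. -/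
theorem integral_fderivWithin (h : IsGraphChart Ω b φ L V) (hΩ : IsBoundedLipschitzDomain Ω)
    {G : Space → ℝ} (hG : ContDiffOn ℝ 1 G (closure Ω)) {K : Set Space} (hK : IsCompact K)
    (hKV : K ⊆ V) (h0 : ∀ x ∉ K, G x = 0) (v : Space) :
    ∫ x in Ω, fderivWithin ℝ G (closure Ω) x v
      = ∫ x, G x * inner ℝ v (outwardNormal Ω x) ∂(surfaceMeasure Ω) := by
  obtain ⟨⟨a, s⟩, rfl⟩ := (chart b).surjective v
  have hφ := h.lipschitzWith
  have hder0 : ∀ x ∉ K, fderiv ℝ G x = 0 := by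
    intro x hx
    have : G =ᶠ[𝓝 x] fun _ => 0 := by
      filter_upwards [hK.isClosed.isOpen_compl.mem_nhds hx] with y hy using h0 y hy
    rw [this.fderiv_eq]
    simp
  set g : GraphCoord → ℝ := G ∘ chart b with hg
  have hgder : ∀ z, fderiv ℝ g z
      = (fderiv ℝ G (chart b z)).comp (chart b : GraphCoord →L[ℝ] Space) :=
    fun z => (chart b).comp_right_fderiv
  have hgK : ∀ z ∉ (chart b).symm '' K, g z = 0 := fun z hz =>
    h0 _ fun hm => hz ⟨_, hm, (chart b).symm_apply_apply z⟩
  have hg0 : ∀ z, chart b z ∉ K → g =ᶠ[𝓝 z] fun _ => 0 := by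
    intro z hz
    filter_upwards [(hK.isClosed.isOpen_compl.preimage (chart b).continuous).mem_nhds hz]
      with w hw using h0 _ hw
  have hgc : ContinuousOn g {z | z.2 ≤ φ z.1} := by
    intro z hz
    by_cases hzK : chart b z ∈ K
    · have hc : ContinuousWithinAt g (chart b ⁻¹' closure Ω) z :=
        (hG.continuousOn _ ((h.mem_closure_iff (hKV hzK)).2 hz)).comp
          (chart b).continuous.continuousWithinAt (mapsTo_preimage _ _)
      refine hc.mono_of_mem_nhdsWithin ?_
      filter_upwards [self_mem_nhdsWithin,
        mem_nhdsWithin_of_mem_nhds (h.isOpen_preimage.mem_nhds (hKV hzK))] with w hw hwV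
      exact (h.mem_closure_iff hwV).2 hw
    · exact ((continuousAt_const (y := (0 : ℝ))).congr (hg0 z hzK).symm).continuousWithinAt
  have hgd : ContDiffOn ℝ 1 g {z | z.2 < φ z.1} := by
    intro z hz
    refine ContDiffAt.contDiffWithinAt ?_
    by_cases hzK : chart b z ∈ K
    · have hzΩ : chart b z ∈ Ω := (h.mem_iff z (hKV hzK)).2 hz
      have : ContDiffAt ℝ 1 G (chart b z) :=
        hG.contDiffAt (mem_of_superset (hΩ.isOpen.mem_nhds hzΩ) subset_closure)
      exact this.comp z (chart b).contDiff.contDiffAt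
    · exact contDiffAt_const.congr_of_eventuallyEq (hg0 z hzK)
  obtain ⟨M, hM⟩ := hΩ.isCompact_closure.exists_bound_of_continuousOn
    (hG.continuousOn_fderivWithin hΩ.uniqueDiffOn_closure le_rfl)
  have hgM : ∀ z : GraphCoord, z.2 < φ z.1 →
      ‖fderiv ℝ g z‖ ≤ |M| * ‖(chart b : GraphCoord →L[ℝ] Space)‖ := by
    intro z hz
    rw [hgder]
    refine (ContinuousLinearMap.opNorm_comp_le _ _).trans ?_
    gcongr
    by_cases hzK : chart b z ∈ K
    · have hzΩ : chart b z ∈ Ω := (h.mem_iff z (hKV hzK)).2 hz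
      rw [← fderivWithin_closure_eq hΩ.isOpen G hzΩ]
      exact (hM _ (subset_closure hzΩ)).trans (le_abs_self M)
    · rw [hder0 _ hzK, norm_zero]
      exact abs_nonneg M
  have hmain := (integral_fderiv_subgraph hφ hgc hgd hgM
    (hK.image (chart b).symm.continuous) hgK a s).2
  -- the left-hand sides agree
  have hleft : ∫ x in Ω, fderivWithin ℝ G (closure Ω) x (chart b (a, s))
      = ∫ z in {z : GraphCoord | z.2 < φ z.1}, fderiv ℝ g z (a, s) := by
    have e1 : ∫ x in Ω, fderivWithin ℝ G (closure Ω) x (chart b (a, s))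
        = ∫ x in Ω ∩ V, fderiv ℝ G x (chart b (a, s)) := by
      rw [setIntegral_congr_fun hΩ.isOpen.measurableSet fun x hx =>
        by rw [fderivWithin_closure_eq hΩ.isOpen G hx]]
      refine (setIntegral_eq_of_subset_of_forall_sdiff_eq_zero hΩ.isOpen.measurableSet
        inter_subset_left fun x hx => ?_)
      rw [hder0 x fun hxK => hx.2 ⟨hx.1, hKV hxK⟩]
      simp
    have e2 : ∫ z in {z : GraphCoord | z.2 < φ z.1}, fderiv ℝ g z (a, s)
        = ∫ z in chart b ⁻¹' (Ω ∩ V), fderiv ℝ G (chart b z) (chart b (a, s)) := by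
      have hset : {z : GraphCoord | z.2 < φ z.1} ∩ chart b ⁻¹' V = chart b ⁻¹' (Ω ∩ V) := by
        ext z
        exact and_congr_left fun hz => (h.mem_iff z hz).symm
      rw [← hset]
      have e3 : ∀ z, fderiv ℝ g z (a, s) = fderiv ℝ G (chart b z) (chart b (a, s)) := fun z => by
        rw [hgder]
        rfl
      simp_rw [e3]
      refine (setIntegral_eq_of_subset_of_forall_sdiff_eq_zero
        (isOpen_subgraph hφ.continuous).measurableSet inter_subset_left fun z hz => ?_)
      rw [hder0 _ fun hxK => hz.2 ⟨hz.1, hKV hxK⟩]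
      simp
    rw [e1, e2]
    exact ((measurePreserving_chart b).setIntegral_preimage_emb
      (chart b).toHomeomorph.measurableEmbedding (fun x => fderiv ℝ G x (chart b (a, s))) _).symm
  -- the right-hand sides agree
  have hright : ∫ x, G x * inner ℝ (chart b (a, s)) (outwardNormal Ω x) ∂(surfaceMeasure Ω)
      = ∫ y, g (y, φ y) * (s - fderiv ℝ φ y a) := by
    rw [← setIntegral_eq_integral_of_forall_compl_eq_zero (s := V) fun x hx => by
        rw [h0 x fun hxK => hx (hKV hxK), zero_mul],
      ← setIntegral_eq_integral_of_forall_compl_eq_zero (s := graphMap b φ ⁻¹' V) fun y hy => by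
        have : G (chart b (y, φ y)) = 0 := h0 _ fun hxK => hy (hKV hxK)
        rw [hg, Function.comp_apply, this, zero_mul],
      h.restrict_surfaceMeasure hΩ.isOpen,
      h.isClosedEmbedding.measurableEmbedding.integral_map,
      integral_withDensity_eq_integral_toReal_smul
        (measurable_graphJacobian_fderiv φ).ennreal_ofReal
        (Eventually.of_forall fun y => ENNReal.ofReal_lt_top)]
    refine integral_congr_ae ?_
    filter_upwards [h.ae_outwardNormal_eq] with y hy
    have hJ := graphJacobian_pos (fderiv ℝ φ y)
    have hgrad : inner ℝ a (gradient φ y) = fderiv ℝ φ y a := by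
      rw [real_inner_comm, gradient, InnerProductSpace.toDual_symm_apply]
    rw [hy, real_inner_smul_right, inner_chart, inner_neg_right, hgrad,
      ENNReal.toReal_ofReal hJ.le, smul_eq_mul, hg, Function.comp_apply, graphMap]
    field_simp
    ring
  rw [hleft, hmain, hright]

end IsGraphChart

theorem IsBoundedLipschitzDomain.isFiniteMeasure_surfaceMeasure
    (hΩ : IsBoundedLipschitzDomain Ω) : IsFiniteMeasure (surfaceMeasure Ω) := by
  constructor
  have h1 : surfaceMeasure Ω univ = surfaceMeasure Ω (frontier Ω) := by
    rw [surfaceMeasure, Measure.restrict_apply_univ, Measure.restrict_apply_self]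
  rw [h1]
  refine hΩ.isCompact_frontier.measure_lt_top_of_nhdsWithin fun x hx => ?_
  obtain ⟨b, φ, L, V, hxV, h⟩ := hΩ.exists_isGraphChart hx
  obtain ⟨K, hK, hxK, hKV⟩ := exists_compact_subset h.isOpen hxV
  exact ⟨K, mem_nhdsWithin_of_mem_nhds (mem_interior_iff_mem_nhds.1 hxK),
    h.surfaceMeasure_lt_top hΩ.isOpen hK hKV⟩

theorem IsBoundedLipschitzDomain.aestronglyMeasurable_outwardNormal
    (hΩ : IsBoundedLipschitzDomain Ω) :
    AEStronglyMeasurable (outwardNormal Ω) (surfaceMeasure Ω) := by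
  have hch : ∀ x : frontier Ω, ∃ V : Set Space, x.1 ∈ V ∧ IsOpen V ∧
      AEStronglyMeasurable (outwardNormal Ω) ((surfaceMeasure Ω).restrict V) := fun x => by
    obtain ⟨b, φ, L, V, hxV, h⟩ := hΩ.exists_isGraphChart x.2
    exact ⟨V, hxV, h.isOpen, h.aestronglyMeasurable_outwardNormal hΩ.isOpen⟩
  choose V hxV hVo hV using hch
  obtain ⟨t, ht⟩ := hΩ.isCompact_frontier.elim_finite_subcover V hVo
    fun x hx => mem_iUnion.2 ⟨⟨x, hx⟩, hxV _⟩
  have hres : surfaceMeasure Ω = (surfaceMeasure Ω).restrict (⋃ i : t, V i) := by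
    refine (Measure.restrict_eq_self_of_ae_mem ?_).symm
    refine (ae_restrict_mem isClosed_frontier.measurableSet).mono fun x hx => ?_
    have := ht hx
    rw [iUnion_subtype]
    exact this
  rw [hres]
  exact aestronglyMeasurable_iUnion_iff.2 fun i => hV i

theorem IsBoundedLipschitzDomain.integrable_mul_inner (hΩ : IsBoundedLipschitzDomain Ω)
    {G : Space → ℝ} (hG : ContinuousOn G (closure Ω)) (v : Space) :
    Integrable (fun x => G x * inner ℝ v (outwardNormal Ω x)) (surfaceMeasure Ω) := by
  have := hΩ.isFiniteMeasure_surfaceMeasure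
  have hGc : ContinuousOn G (frontier Ω) := hG.mono frontier_subset_closure
  obtain ⟨M, hM⟩ := hΩ.isCompact_frontier.exists_bound_of_continuousOn hGc
  refine Integrable.of_bound (C := M * ‖v‖)
    ((hGc.aestronglyMeasurable isClosed_frontier.measurableSet).mul
      (aestronglyMeasurable_const.inner hΩ.aestronglyMeasurable_outwardNormal)) ?_
  refine (ae_restrict_mem isClosed_frontier.measurableSet).mono fun x hx => ?_
  rw [norm_mul]
  have h1 : ‖inner ℝ v (outwardNormal Ω x)‖ ≤ ‖v‖ * 1 :=
    (norm_inner_le_norm _ _).trans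
      (mul_le_mul_of_nonneg_left (norm_outwardNormal_le Ω x) (norm_nonneg v))
  rw [mul_one] at h1
  exact mul_le_mul (hM x hx) h1 (norm_nonneg _) ((norm_nonneg _).trans (hM x hx))

/-- The divergence theorem for a function that vanishes near the boundary. -/
theorem IsBoundedLipschitzDomain.integral_fderivWithin_of_eq_zero
    (hΩ : IsBoundedLipschitzDomain Ω) {G : Space → ℝ} (hG : ContDiffOn ℝ 1 G (closure Ω))
    {N : Set Space} (hN : IsOpen N) (hfN : frontier Ω ⊆ N) (h0 : ∀ x ∈ N, G x = 0) (v : Space) :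
    ∫ x in Ω, fderivWithin ℝ G (closure Ω) x v
      = ∫ x, G x * inner ℝ v (outwardNormal Ω x) ∂(surfaceMeasure Ω) := by
  have hr : ∫ x, G x * inner ℝ v (outwardNormal Ω x) ∂(surfaceMeasure Ω) = 0 := by
    refine setIntegral_eq_zero_of_forall_eq_zero fun x hx => ?_
    rw [h0 x (hfN hx), zero_mul]
  set K := closure Ω \ N with hKdef
  have hK : IsCompact K := hΩ.isCompact_closure.diff hN
  have hKΩ : K ⊆ Ω := fun x hx => by
    by_contra hxΩ
    exact hx.2 (hfN (by rw [hΩ.isOpen.frontier_eq]; exact ⟨hx.1, hxΩ⟩))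
  set H : Space → ℝ := indicator Ω G with hH
  have hHK : ∀ x ∉ K, H x = 0 := by
    intro x hx
    by_cases hxΩ : x ∈ Ω
    · rw [hH, indicator_of_mem hxΩ]
      exact h0 x (by_contra fun hxN => hx ⟨subset_closure hxΩ, hxN⟩)
    · exact indicator_of_notMem hxΩ _
  have hHeq : ∀ x ∈ Ω, H =ᶠ[𝓝 x] G := fun x hx => by
    filter_upwards [hΩ.isOpen.mem_nhds hx] with y hy using indicator_of_mem hy _
  have hHs : ContDiff ℝ 1 H := by
    refine contDiff_iff_contDiffAt.2 fun x => ?_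
    by_cases hx : x ∈ K
    · exact (hG.contDiffAt (mem_of_superset (hΩ.isOpen.mem_nhds (hKΩ hx)) subset_closure)
        ).congr_of_eventuallyEq (hHeq x (hKΩ hx))
    · refine (contDiffAt_const (c := (0 : ℝ))).congr_of_eventuallyEq ?_
      filter_upwards [hK.isClosed.isOpen_compl.mem_nhds hx] with y hy using hHK y hy
  have hHc : HasCompactSupport H := HasCompactSupport.intro hK hHK
  obtain ⟨C, hC⟩ := hHs.lipschitzWith_of_hasCompactSupport hHc one_ne_zero
  have hline : ∀ x, lineDeriv ℝ H x v = fderiv ℝ H x v := fun x =>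
    (hHs.differentiable one_ne_zero x).lineDeriv_eq_fderiv
  have hl : ∫ x in Ω, fderivWithin ℝ G (closure Ω) x v = ∫ x in Ω, lineDeriv ℝ H x v := by
    refine setIntegral_congr_fun hΩ.isOpen.measurableSet fun x hx => ?_
    rw [fderivWithin_closure_eq hΩ.isOpen G hx, ← (hHeq x hx).fderiv_eq, hline]
  rw [hr, hl, ← integral_lineDeriv_eq_zero (μ := volume) hC hHc v]
  refine setIntegral_eq_integral_of_forall_compl_eq_zero fun x hx => ?_
  have : H =ᶠ[𝓝 x] fun _ => 0 := by
    filter_upwards [hK.isClosed.isOpen_compl.mem_nhds fun hxK => hx (hKΩ hxK)] with y hy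
      using hHK y hy
  rw [hline, this.fderiv_eq]
  simp

/-- The divergence theorem on a bounded Lipschitz domain, for a single function and a constant
direction. The function is cut off by a finite partition of unity, so that each part is supported
in a graph chart or vanishes near the boundary. -/
theorem IsBoundedLipschitzDomain.integral_fderivWithin (hΩ : IsBoundedLipschitzDomain Ω)
    {G : Space → ℝ} (hG : ContDiffOn ℝ 1 G (closure Ω)) (v : Space) :
    ∫ x in Ω, fderivWithin ℝ G (closure Ω) x v
      = ∫ x, G x * inner ℝ v (outwardNormal Ω x) ∂(surfaceMeasure Ω) := by
  have hch : ∀ p : frontier Ω, ∃ (χ : Space → ℝ) (U : Set Space), ContDiff ℝ 1 χ ∧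
      IsOpen U ∧ p.1 ∈ U ∧ (∀ x ∈ U, χ x = 1) ∧
      ∀ {F : Space → ℝ}, ContDiffOn ℝ 1 F (closure Ω) →
        ∫ x in Ω, fderivWithin ℝ (fun x => F x * χ x) (closure Ω) x v
          = ∫ x, F x * χ x * inner ℝ v (outwardNormal Ω x) ∂(surfaceMeasure Ω) := fun p => by
    obtain ⟨b, φ, L, V, hxV, h⟩ := hΩ.exists_isGraphChart p.2
    obtain ⟨C, hC, hxC, hCV⟩ := exists_compact_subset h.isOpen hxV
    obtain ⟨χ, K, hχ, hK, hKV, h1, h0⟩ := exists_contDiff_cutoff hC h.isOpen hCV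
    refine ⟨χ, interior C, hχ, isOpen_interior, hxC, fun x hx => h1 x (interior_subset hx),
      fun hF => ?_⟩
    exact h.integral_fderivWithin hΩ (hF.mul hχ.contDiffOn) hK hKV
      (fun x hx => by rw [h0 x hx, mul_zero]) v
  choose χ U hχ hUo hU h1 hloc using hch
  obtain ⟨t, ht⟩ := hΩ.isCompact_frontier.elim_finite_subcover U hUo
    fun x hx => mem_iUnion.2 ⟨⟨x, hx⟩, hU _⟩
  -- induction on the number of charts, with the decomposition `F = F χ + F (1 - χ)`
  have key : ∀ (s : Finset (frontier Ω)) {F : Space → ℝ}, ContDiffOn ℝ 1 F (closure Ω) →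
      (∫ x in Ω, fderivWithin ℝ (fun x => F x * ∏ p ∈ s, (1 - χ p x)) (closure Ω) x v
        = ∫ x, F x * (∏ p ∈ s, (1 - χ p x)) * inner ℝ v (outwardNormal Ω x)
          ∂(surfaceMeasure Ω)) →
      ∫ x in Ω, fderivWithin ℝ F (closure Ω) x v
        = ∫ x, F x * inner ℝ v (outwardNormal Ω x) ∂(surfaceMeasure Ω) := by
    classical
    intro s
    induction s using Finset.induction_on with
    | empty => exact fun _ h => by simpa using h
    | insert q s hq ih =>
      intro F hF h
      have hF1 : ContDiffOn ℝ 1 (fun x => F x * χ q x) (closure Ω) :=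
        hF.mul (hχ q).contDiffOn
      have hF2 : ContDiffOn ℝ 1 (fun x => F x * (1 - χ q x)) (closure Ω) :=
        hF.mul (contDiff_const.sub (hχ q)).contDiffOn
      simp only [Finset.prod_insert hq, ← mul_assoc] at h
      have e2 := ih hF2 h
      have e1 := hloc q hF
      have hd : ∀ x ∈ Ω, fderivWithin ℝ F (closure Ω) x v
          = fderivWithin ℝ (fun x => F x * χ q x) (closure Ω) x v
            + fderivWithin ℝ (fun x => F x * (1 - χ q x)) (closure Ω) x v := by
        intro x hx
        have hx' := subset_closure hx
        rw [← add_apply, ← fderivWithin_fun_add (hΩ.uniqueDiffOn_closure x hx')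
          (hF1.differentiableOn one_ne_zero x hx') (hF2.differentiableOn one_ne_zero x hx')]
        congr 2
        funext y
        ring
      rw [setIntegral_congr_fun hΩ.isOpen.measurableSet hd,
        integral_add (hΩ.integrableOn_fderivWithin hF1 v) (hΩ.integrableOn_fderivWithin hF2 v),
        e1, e2, ← integral_add (hΩ.integrable_mul_inner hF1.continuousOn v)
          (hΩ.integrable_mul_inner hF2.continuousOn v)]
      congr 1
      funext x
      ring
  refine key t hG (hΩ.integral_fderivWithin_of_eq_zero ?_
    (isOpen_biUnion fun p (_ : p ∈ t) => hUo p) ht ?_ v)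
  · exact hG.mul (ContDiff.contDiffOn (contDiff_prod fun p _ => contDiff_const.sub (hχ p)))
  · intro x hx
    obtain ⟨p, hp, hxp⟩ := mem_iUnion₂.1 hx
    rw [Finset.prod_eq_zero hp (by rw [h1 p x hxp, sub_self]), mul_zero]

end DivergenceTheorem

/-! ### The entropy balance along a curve of states -/

section EntropyAlgebra

theorem mkState_dotProduct (a a' e e' z z' : ℝ) (m m' b b' : Fin 3 → ℝ) :
    mkState a m e b z ⬝ᵥ mkState a' m' e' b' z'
      = a * a' + m ⬝ᵥ m' + e * e' + b ⬝ᵥ b' + z * z' := by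
  simp [mkState, dotProduct, Fin.sum_univ_succ]
  ring

theorem hasDerivAt_mkState {a e z : ℝ → ℝ} {m b : ℝ → Fin 3 → ℝ} {a' e' z' t : ℝ}
    {m' b' : Fin 3 → ℝ} (ha : HasDerivAt a a' t) (hm : HasDerivAt m m' t)
    (he : HasDerivAt e e' t) (hb : HasDerivAt b b' t) (hz : HasDerivAt z z' t) :
    HasDerivAt (fun s => mkState (a s) (m s) (e s) (b s) (z s)) (mkState a' m' e' b' z') t := by
  rw [hasDerivAt_pi] at hm hb ⊢
  intro i
  fin_cases i
  exacts [ha, hm 0, hm 1, hm 2, he, hb 0, hb 1, hb 2, hz]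

theorem hasDerivAt_dotProduct {a b : ℝ → Fin 3 → ℝ} {a' b' : Fin 3 → ℝ} {t : ℝ}
    (ha : HasDerivAt a a' t) (hb : HasDerivAt b b' t) :
    HasDerivAt (fun s => a s ⬝ᵥ b s) (a' ⬝ᵥ b t + a t ⬝ᵥ b') t := by
  rw [hasDerivAt_pi] at ha hb
  simp only [dotProduct, ← Finset.sum_add_distrib]
  exact HasDerivAt.fun_sum fun i _ => (ha i).mul (hb i)

/-- A state is determined by its density, velocity, pressure, magnetic field and cleaning
variable. -/
theorem eq_mkState (c : Constants) (hγ : c.adiabatic ≠ 1) {u : State} (hρ : density u ≠ 0) :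
    u = mkState (density u) (density u • velocity u)
      (pressure c u / (c.adiabatic - 1) + 1 / 2 * density u * (velocity u ⬝ᵥ velocity u)
        + 1 / 2 * (magnetic u ⬝ᵥ magnetic u) + 1 / 2 * cleaning u ^ 2)
      (magnetic u) (cleaning u) := by
  have hγ' : c.adiabatic - 1 ≠ 0 := sub_ne_zero.2 hγ
  have he : pressure c u / (c.adiabatic - 1) + 1 / 2 * density u * (velocity u ⬝ᵥ velocity u)
        + 1 / 2 * (magnetic u ⬝ᵥ magnetic u) + 1 / 2 * cleaning u ^ 2 = energy u := by
    rw [pressure, mul_div_cancel_left₀ _ hγ']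
    ring
  rw [he]
  have hρ' : u 0 ≠ 0 := hρ
  ext i
  fin_cases i <;> simp [mkState, density, velocity, energy, magnetic, cleaning] <;> field_simp

/-- Along the curve of states `U`, the density, the velocity, the pressure, the magnetic field and
the cleaning variable have the given derivatives at the time `t`. -/
structure HasPrimitiveDerivAt (c : Constants) (U : ℝ → State) (t : ℝ) (r' : ℝ) (v' : Fin 3 → ℝ)
    (p' : ℝ) (b' : Fin 3 → ℝ) (z' : ℝ) : Prop where
  density : HasDerivAt (fun s => density (U s)) r' t
  velocity : HasDerivAt (fun s => velocity (U s)) v' t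
  pressure : HasDerivAt (fun s => pressure c (U s)) p' t
  magnetic : HasDerivAt (fun s => magnetic (U s)) b' t
  cleaning : HasDerivAt (fun s => cleaning (U s)) z' t

theorem differentiableAt_velocity {u : State} (hρ : density u ≠ 0) :
    DifferentiableAt ℝ velocity u := by
  have hρ' : u 0 ≠ 0 := hρ
  rw [differentiableAt_pi]
  intro i
  fin_cases i <;> simp only [velocity] <;> simp <;> fun_prop (disch := exact hρ')

theorem differentiable_magnetic : Differentiable ℝ magnetic := by
  rw [differentiable_pi]
  intro i
  fin_cases i <;> simp only [magnetic] <;> simp <;> fun_prop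

theorem differentiableAt_pressure (c : Constants) {u : State} (hρ : density u ≠ 0) :
    DifferentiableAt ℝ (pressure c) u := by
  have hv := differentiableAt_velocity hρ
  have hb := differentiable_magnetic u
  rw [differentiableAt_pi] at hv hb
  have h0 := hv 0
  have h1 := hv 1
  have h2 := hv 2
  have h3 := hb 0
  have h4 := hb 1
  have h5 := hb 2
  unfold pressure
  simp only [dotProduct, Fin.sum_univ_three, energy, density, cleaning]
  fun_prop

theorem exists_hasPrimitiveDerivAt (c : Constants) {U : ℝ → State} {U' : State} {t : ℝ}
    (hU : HasDerivAt U U' t) (hρ : density (U t) ≠ 0) :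
    ∃ r' v' p' b' z', HasPrimitiveDerivAt c U t r' v' p' b' z' := by
  have hv := (differentiableAt_velocity hρ).hasFDerivAt.comp_hasDerivAt t hU
  have hp := (differentiableAt_pressure c hρ).hasFDerivAt.comp_hasDerivAt t hU
  have hb := (differentiable_magnetic (U t)).hasFDerivAt.comp_hasDerivAt t hU
  exact ⟨_, _, _, _, _, ⟨hasDerivAt_pi.1 hU 0, hv, hp, hb, hasDerivAt_pi.1 hU 8⟩⟩

/-- The explicit form of the entropy variables. -/
noncomputable def entropyVarsFormula (c : Constants) (u : State) : State :=
  mkState ((c.adiabatic - Real.log (pressure c u * density u ^ (-c.adiabatic)))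
      / (c.adiabatic - 1) - density u / pressure c u * (velocity u ⬝ᵥ velocity u) / 2)
    ((density u / pressure c u) • velocity u) (-(density u / pressure c u))
    ((density u / pressure c u) • magnetic u) (density u / pressure c u * cleaning u)

namespace HasPrimitiveDerivAt

variable {c : Constants} {U : ℝ → State} {U' : State} {t r' p' z' : ℝ} {v' b' : Fin 3 → ℝ}

theorem eq_mkState (h : HasPrimitiveDerivAt c U t r' v' p' b' z') (hγ : c.adiabatic ≠ 1)
    (hU : HasDerivAt U U' t) (hρ : GLMMHD.density (U t) ≠ 0) :
    U' = mkState r' (GLMMHD.density (U t) • v' + r' • GLMMHD.velocity (U t))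
      (p' / (c.adiabatic - 1) + (1 / 2 * r' * (GLMMHD.velocity (U t) ⬝ᵥ GLMMHD.velocity (U t))
          + GLMMHD.density (U t) * (GLMMHD.velocity (U t) ⬝ᵥ v'))
        + GLMMHD.magnetic (U t) ⬝ᵥ b' + GLMMHD.cleaning (U t) * z')
      b' z' := by
  have hev : ∀ᶠ s in 𝓝 t, GLMMHD.density (U s) ≠ 0 := h.density.continuousAt.eventually_ne hρ
  have h1 := (hasDerivAt_mkState h.density (h.density.smul h.velocity)
    ((((h.pressure.div_const (c.adiabatic - 1)).add
      ((h.density.const_mul (1 / 2)).mul (hasDerivAt_dotProduct h.velocity h.velocity))).add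
      ((hasDerivAt_dotProduct h.magnetic h.magnetic).const_mul (1 / 2))).add
      ((h.cleaning.pow 2).const_mul (1 / 2))) h.magnetic h.cleaning).congr_of_eventuallyEq
      (hev.mono fun s hs => GLMMHD.eq_mkState c hγ hs)
  rw [hU.unique h1]
  congr 1
  rw [dotProduct_comm v', dotProduct_comm b']
  simp
  ring

theorem hasDerivAt_entropy (h : HasPrimitiveDerivAt c U t r' v' p' b' z')
    (hρ : 0 < GLMMHD.density (U t)) (hp : 0 < GLMMHD.pressure c (U t)) :
    HasDerivAt (fun s => entropy c (U s))
      (-(r' * Real.log (GLMMHD.pressure c (U t) * GLMMHD.density (U t) ^ (-c.adiabatic))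
        + (GLMMHD.density (U t) / GLMMHD.pressure c (U t) * p' - c.adiabatic * r'))
        / (c.adiabatic - 1)) t := by
  have hpow := h.density.rpow_const (p := -c.adiabatic) (Or.inl hρ.ne')
  have hpos : 0 < GLMMHD.density (U t) ^ (-c.adiabatic) := Real.rpow_pos_of_pos hρ _
  have h1 := ((h.density.mul ((h.pressure.mul hpow).log (mul_pos hp hpos).ne')).neg).div_const
    (c.adiabatic - 1)
  refine h1.congr_deriv ?_
  congr 2
  rw [Real.rpow_sub hρ, Real.rpow_one]
  simp only [Pi.mul_apply]
  field_simp
  ring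

/-- The gradient of the entropy is given by the formula for the entropy variables. -/
theorem hasDerivAt_entropy_dotProduct (h : HasPrimitiveDerivAt c U t r' v' p' b' z')
    (hγ : c.adiabatic ≠ 1) (hU : HasDerivAt U U' t) (hρ : 0 < GLMMHD.density (U t))
    (hp : 0 < GLMMHD.pressure c (U t)) :
    HasDerivAt (fun s => entropy c (U s)) (entropyVarsFormula c (U t) ⬝ᵥ U') t := by
  have hγ' : c.adiabatic - 1 ≠ 0 := sub_ne_zero.2 hγ
  refine (h.hasDerivAt_entropy hρ hp).congr_deriv ?_
  rw [h.eq_mkState hγ hU hρ.ne', entropyVarsFormula, mkState_dotProduct]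
  simp only [dotProduct, Fin.sum_univ_three, Pi.add_apply, Pi.smul_apply, smul_eq_mul]
  field_simp
  ring

theorem hasDerivAt_advectiveFlux (h : HasPrimitiveDerivAt c U t r' v' p' b' z') (l : Fin 3) :
    HasDerivAt (fun s => advectiveFlux c (U s) l)
      (mkState (r' * GLMMHD.velocity (U t) l + GLMMHD.density (U t) * v' l)
        (fun k => (r' * GLMMHD.velocity (U t) l + GLMMHD.density (U t) * v' l)
            * GLMMHD.velocity (U t) k
          + GLMMHD.density (U t) * GLMMHD.velocity (U t) l * v' k
          + p' * (1 : Matrix (Fin 3) (Fin 3) ℝ) l k)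
        (v' l * (1 / 2 * GLMMHD.density (U t)
            * (GLMMHD.velocity (U t) ⬝ᵥ GLMMHD.velocity (U t))
            + c.adiabatic * GLMMHD.pressure c (U t) / (c.adiabatic - 1))
          + GLMMHD.velocity (U t) l * (1 / 2 * r'
            * (GLMMHD.velocity (U t) ⬝ᵥ GLMMHD.velocity (U t))
            + GLMMHD.density (U t) * (GLMMHD.velocity (U t) ⬝ᵥ v')
            + c.adiabatic * p' / (c.adiabatic - 1)))
        0 0
      + mkState 0
        (fun k => (GLMMHD.magnetic (U t) ⬝ᵥ b') * (1 : Matrix (Fin 3) (Fin 3) ℝ) l k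
          - (b' l * GLMMHD.magnetic (U t) k + GLMMHD.magnetic (U t) l * b' k))
        (v' l * (GLMMHD.magnetic (U t) ⬝ᵥ GLMMHD.magnetic (U t))
          + GLMMHD.velocity (U t) l * (2 * (GLMMHD.magnetic (U t) ⬝ᵥ b'))
          - (b' l * (GLMMHD.velocity (U t) ⬝ᵥ GLMMHD.magnetic (U t))
            + GLMMHD.magnetic (U t) l
              * (v' ⬝ᵥ GLMMHD.magnetic (U t) + GLMMHD.velocity (U t) ⬝ᵥ b')))
        (fun k => v' l * GLMMHD.magnetic (U t) k + GLMMHD.velocity (U t) l * b' k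
          - (b' l * GLMMHD.velocity (U t) k + GLMMHD.magnetic (U t) l * v' k))
        0
      + mkState 0 0
        (c.cleaningSpeed * z' * GLMMHD.magnetic (U t) l
          + c.cleaningSpeed * GLMMHD.cleaning (U t) * b' l)
        (fun k => c.cleaningSpeed * z' * (1 : Matrix (Fin 3) (Fin 3) ℝ) l k)
        (c.cleaningSpeed * b' l)) t := by
  have hr := h.density
  have hp := h.pressure
  have hz := h.cleaning
  have hv := hasDerivAt_pi.1 h.velocity
  have hb := hasDerivAt_pi.1 h.magnetic
  have hvv := hasDerivAt_dotProduct h.velocity h.velocity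
  have hbb := hasDerivAt_dotProduct h.magnetic h.magnetic
  have hvb := hasDerivAt_dotProduct h.velocity h.magnetic
  have h0 : HasDerivAt (fun _ : ℝ => (0 : Fin 3 → ℝ)) 0 t := hasDerivAt_const t _
  have h0' : HasDerivAt (fun _ : ℝ => (0 : ℝ)) 0 t := hasDerivAt_const t _
  refine HasDerivAt.add (HasDerivAt.add ?_ ?_) ?_
  · refine hasDerivAt_mkState (hr.mul (hv l)) (hasDerivAt_pi.2 fun k => ?_) ?_ h0 h0'
    · exact ((hr.mul (hv l)).mul (hv k)).add (hp.mul_const _)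
    · refine ((hv l).mul (((hr.const_mul (1 / 2)).mul hvv).add
        ((hp.const_mul c.adiabatic).div_const (c.adiabatic - 1)))).congr_deriv ?_
      rw [dotProduct_comm v']
      simp only [Pi.add_apply, Pi.mul_apply]
      ring
  · refine hasDerivAt_mkState h0' (hasDerivAt_pi.2 fun k => ?_) ?_ (hasDerivAt_pi.2 fun k => ?_) h0'
    · refine (((hbb.const_mul (1 / 2)).mul_const _).sub ((hb l).mul (hb k))).congr_deriv ?_
      rw [dotProduct_comm b']
      ring
    · refine (((hv l).mul hbb).sub ((hb l).mul hvb)).congr_deriv ?_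
      rw [dotProduct_comm b']
      ring
    · exact ((hv l).mul (hb k)).sub ((hb l).mul (hv k))
  · refine hasDerivAt_mkState h0' h0 ?_ (hasDerivAt_pi.2 fun k => ?_) ((hb l).const_mul _)
    · exact (hz.const_mul _).mul (hb l)
    · exact (hz.const_mul _).mul_const _

/-- In each direction, the advective flux and the non-conservative terms, contracted with the
entropy variables, give the derivative of the entropy flux: smooth solutions of the ideal system
conserve the entropy. -/
theorem hasDerivAt_entropyFlux (h : HasPrimitiveDerivAt c U t r' v' p' b' z')
    (hγ : c.adiabatic ≠ 1) (hρ : 0 < GLMMHD.density (U t)) (hp : 0 < GLMMHD.pressure c (U t))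
    (l : Fin 3) {F : State} (hF : HasDerivAt (fun s => advectiveFlux c (U s) l) F t) :
    HasDerivAt (fun s => entropyFlux c (U s) l)
      (entropyVarsFormula c (U t) ⬝ᵥ (F
        + (b' l • mkState 0 (GLMMHD.magnetic (U t))
            (GLMMHD.velocity (U t) ⬝ᵥ GLMMHD.magnetic (U t)) (GLMMHD.velocity (U t)) 0
          + z' • mkState 0 0 (GLMMHD.velocity (U t) l * GLMMHD.cleaning (U t)) 0
            (GLMMHD.velocity (U t) l)))) t := by
  have hγ' : c.adiabatic - 1 ≠ 0 := sub_ne_zero.2 hγ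
  refine ((h.hasDerivAt_entropy hρ hp).mul (hasDerivAt_pi.1 h.velocity l)).congr_deriv ?_
  rw [hF.unique (h.hasDerivAt_advectiveFlux l)]
  simp only [dotProduct_add, dotProduct_smul, entropyVarsFormula, mkState_dotProduct, entropy]
  generalize Real.log (GLMMHD.pressure c (U t) * GLMMHD.density (U t) ^ (-c.adiabatic)) = σ
  generalize GLMMHD.pressure c (U t) = p at *
  generalize GLMMHD.density (U t) = r at *
  generalize GLMMHD.cleaning (U t) = z at *
  generalize GLMMHD.velocity (U t) = v at *
  generalize GLMMHD.magnetic (U t) = b at *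
  fin_cases l <;>
  · simp [dotProduct, Fin.sum_univ_three, Matrix.one_apply]
    field_simp
    ring

end HasPrimitiveDerivAt

theorem differentiableAt_entropy (c : Constants) {u : State} (hρ : 0 < density u)
    (hp : 0 < pressure c u) : DifferentiableAt ℝ (entropy c) u := by
  have h1 : DifferentiableAt ℝ density u := differentiableAt_apply 0 u
  have h2 := differentiableAt_pressure c hρ.ne'
  have hpos : 0 < density u ^ (-c.adiabatic) := Real.rpow_pos_of_pos hρ _
  exact ((h1.mul ((h2.mul (h1.rpow_const (Or.inl hρ.ne'))).log (mul_pos hp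
    hpos).ne')).neg).mul_const _

theorem entropyVars_eq (c : Constants) (hγ : c.adiabatic ≠ 1) {u : State} (hρ : 0 < density u)
    (hp : 0 < pressure c u) : entropyVars c u = entropyVarsFormula c u := by
  funext k
  have hU : HasDerivAt (fun s : ℝ => u + s • (Pi.single k 1 : State)) (Pi.single k 1) 0 := by
    simpa using ((hasDerivAt_id (0 : ℝ)).smul_const (Pi.single k 1 : State)).const_add u
  have h0 : u + (0 : ℝ) • (Pi.single k 1 : State) = u := by simp
  obtain ⟨r', v', p', b', z', h⟩ := exists_hasPrimitiveDerivAt c hU (by simpa using hρ.ne')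
  have h1 := h.hasDerivAt_entropy_dotProduct hγ hU (by simpa using hρ) (by simpa using hp)
  have h2 := HasFDerivAt.comp_hasDerivAt (0 : ℝ)
    (by rw [h0]; exact (differentiableAt_entropy c hρ hp).hasFDerivAt) hU
  rw [h0] at h1
  rw [entropyVars, h2.unique h1, dotProduct_single, mul_one]

end EntropyAlgebra

/-! ### Regularity of the fluxes -/

section Regularity

variable {n : WithTop ℕ∞} {X : Type*} [NormedAddCommGroup X] [NormedSpace ℝ X] {K : Set X}

theorem contDiffOn_mkState {a e z : X → ℝ} {m b : X → Fin 3 → ℝ} (ha : ContDiffOn ℝ n a K)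
    (hm : ∀ k, ContDiffOn ℝ n (fun x => m x k) K) (he : ContDiffOn ℝ n e K)
    (hb : ∀ k, ContDiffOn ℝ n (fun x => b x k) K) (hz : ContDiffOn ℝ n z K) :
    ContDiffOn ℝ n (fun x => mkState (a x) (m x) (e x) (b x) (z x)) K := by
  rw [contDiffOn_pi]
  intro i
  fin_cases i
  exacts [ha, hm 0, hm 1, hm 2, he, hb 0, hb 1, hb 2, hz]

theorem contDiffOn_dotProduct {ι : Type*} [Fintype ι] {a b : X → ι → ℝ}
    (ha : ∀ k, ContDiffOn ℝ n (fun x => a x k) K) (hb : ∀ k, ContDiffOn ℝ n (fun x => b x k) K) :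
    ContDiffOn ℝ n (fun x => a x ⬝ᵥ b x) K :=
  ContDiffOn.sum fun k _ => (ha k).mul (hb k)

theorem contDiffOn_magnetic {U : X → State} (hU : ContDiffOn ℝ n U K) (k : Fin 3) :
    ContDiffOn ℝ n (fun x => magnetic (U x) k) K := by
  have h := contDiffOn_pi.1 hU
  fin_cases k
  exacts [h 5, h 6, h 7]

theorem contDiffOn_density {U : X → State} (hU : ContDiffOn ℝ n U K) :
    ContDiffOn ℝ n (fun x => density (U x)) K := contDiffOn_pi.1 hU 0

theorem contDiffOn_cleaning {U : X → State} (hU : ContDiffOn ℝ n U K) :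
    ContDiffOn ℝ n (fun x => cleaning (U x)) K := contDiffOn_pi.1 hU 8

theorem contDiffOn_velocity {U : X → State} (hU : ContDiffOn ℝ n U K)
    (hρ : ∀ x ∈ K, 0 < density (U x)) (k : Fin 3) :
    ContDiffOn ℝ n (fun x => velocity (U x) k) K := by
  have h := contDiffOn_pi.1 hU
  have hρ' : ∀ x ∈ K, U x 0 ≠ 0 := fun x hx => (hρ x hx).ne'
  fin_cases k
  exacts [(h 1).div (h 0) hρ', (h 2).div (h 0) hρ', (h 3).div (h 0) hρ']

theorem contDiffOn_pressure (c : Constants) {U : X → State} (hU : ContDiffOn ℝ n U K)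
    (hρ : ∀ x ∈ K, 0 < density (U x)) : ContDiffOn ℝ n (fun x => pressure c (U x)) K := by
  have hv := contDiffOn_velocity hU hρ
  have hb := contDiffOn_magnetic hU
  have he : ContDiffOn ℝ n (fun x => energy (U x)) K := contDiffOn_pi.1 hU 4
  exact contDiffOn_const.mul (((he.sub
    ((contDiffOn_const.mul (contDiffOn_density hU)).mul (contDiffOn_dotProduct hv hv))).sub
    (contDiffOn_const.mul (contDiffOn_dotProduct hb hb))).sub
    (contDiffOn_const.mul ((contDiffOn_cleaning hU).pow 2)))

theorem contDiffOn_advectiveFlux (c : Constants) {U : X → State} (hU : ContDiffOn ℝ n U K)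
    (hρ : ∀ x ∈ K, 0 < density (U x)) (l : Fin 3) :
    ContDiffOn ℝ n (fun x => advectiveFlux c (U x) l) K := by
  have hr := contDiffOn_density hU
  have hz := contDiffOn_cleaning hU
  have hp := contDiffOn_pressure c hU hρ
  have hv := contDiffOn_velocity hU hρ
  have hb := contDiffOn_magnetic hU
  have hvv := contDiffOn_dotProduct hv hv
  have hbb := contDiffOn_dotProduct hb hb
  have hvb := contDiffOn_dotProduct hv hb
  refine ContDiffOn.add (ContDiffOn.add ?_ ?_) ?_
  · refine contDiffOn_mkState (hr.mul (hv l)) (fun k => ?_) ?_ (fun _ => contDiffOn_const)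
      contDiffOn_const
    · exact ((hr.mul (hv l)).mul (hv k)).add (hp.mul contDiffOn_const)
    · exact (hv l).mul (((contDiffOn_const.mul hr).mul hvv).add
        ((contDiffOn_const.mul hp).div_const _))
  · refine contDiffOn_mkState contDiffOn_const (fun k => ?_) ?_ (fun k => ?_) contDiffOn_const
    · exact ((contDiffOn_const.mul hbb).mul contDiffOn_const).sub ((hb l).mul (hb k))
    · exact ((hv l).mul hbb).sub ((hb l).mul hvb)
    · exact ((hv l).mul (hb k)).sub ((hb l).mul (hv k))
  · refine contDiffOn_mkState contDiffOn_const (fun _ => contDiffOn_const) ?_ (fun k => ?_)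
      (contDiffOn_const.mul (hb l))
    · exact (contDiffOn_const.mul hz).mul (hb l)
    · exact (contDiffOn_const.mul hz).mul contDiffOn_const

theorem contDiffOn_log_pressure_mul (c : Constants) {U : X → State} (hU : ContDiffOn ℝ n U K)
    (hρ : ∀ x ∈ K, 0 < density (U x)) (hp : ∀ x ∈ K, 0 < pressure c (U x)) :
    ContDiffOn ℝ n
      (fun x => Real.log (pressure c (U x) * density (U x) ^ (-c.adiabatic))) K :=
  ((contDiffOn_pressure c hU hρ).mul
    ((contDiffOn_density hU).rpow_const_of_ne fun x hx => (hρ x hx).ne')).log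
    fun x hx => (mul_pos (hp x hx) (Real.rpow_pos_of_pos (hρ x hx) _)).ne'

theorem contDiffOn_entropyFlux (c : Constants) {U : X → State} (hU : ContDiffOn ℝ n U K)
    (hρ : ∀ x ∈ K, 0 < density (U x)) (hp : ∀ x ∈ K, 0 < pressure c (U x)) (l : Fin 3) :
    ContDiffOn ℝ n (fun x => entropyFlux c (U x) l) K :=
  ((((contDiffOn_density hU).mul (contDiffOn_log_pressure_mul c hU hρ hp)).neg).div_const _).mul
    (contDiffOn_velocity hU hρ l)

theorem contDiffOn_entropyVars (c : Constants) (hγ : c.adiabatic ≠ 1) {U : X → State}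
    (hU : ContDiffOn ℝ n U K)
    (hρ : ∀ x ∈ K, 0 < density (U x)) (hp : ∀ x ∈ K, 0 < pressure c (U x)) :
    ContDiffOn ℝ n (fun x => entropyVars c (U x)) K := by
  have hv := contDiffOn_velocity hU hρ
  have hβ := (contDiffOn_density hU).div (contDiffOn_pressure c hU hρ) fun x hx => (hp x hx).ne'
  refine ContDiffOn.congr ?_ fun x hx => entropyVars_eq c hγ (hρ x hx) (hp x hx)
  refine contDiffOn_mkState ?_ (fun k => ?_) ?_ (fun k => ?_) ?_
  · exact ((contDiffOn_const.sub (contDiffOn_log_pressure_mul c hU hρ hp)).div_const _).sub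
      ((hβ.mul (contDiffOn_dotProduct hv hv)).div_const _)
  · exact hβ.mul (hv k)
  · exact hβ.neg
  · exact hβ.mul (contDiffOn_magnetic hU k)
  · exact hβ.mul (contDiffOn_cleaning hU)

theorem contDiffOn_pd {K : Set Space} (hK : UniqueDiffOn ℝ K) {m : WithTop ℕ∞}
    (hmn : m + 1 ≤ n) {f : Space → ℝ} (hf : ContDiffOn ℝ n f K) (i : Fin 3) :
    ContDiffOn ℝ m (pd K i f) K :=
  (hf.fderivWithin hK hmn).clm_apply contDiffOn_const

theorem contDiffOn_viscousFlux (c : Constants) (hR : c.gasConst ≠ 0) {K : Set Space}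
    (hK : UniqueDiffOn ℝ K)
    {U : Space → State} (hU : ContDiffOn ℝ 2 U K) (hρ : ∀ x ∈ K, 0 < density (U x)) (l : Fin 3) :
    ContDiffOn ℝ 1 (fun x => viscousFlux c K U x l) K := by
  have h12 : (1 : WithTop ℕ∞) ≤ 2 := by norm_num
  have h2 : (1 : WithTop ℕ∞) + 1 ≤ 2 := by norm_num
  have hU1 := hU.of_le h12
  have hv1 := contDiffOn_velocity hU1 hρ
  have hb1 := contDiffOn_magnetic hU1
  have hdv : ∀ i k, ContDiffOn ℝ 1 (pd K i fun y => velocity (U y) k) K := fun i k =>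
    contDiffOn_pd hK h2 (contDiffOn_velocity hU hρ k) i
  have hdb : ∀ i k, ContDiffOn ℝ 1 (pd K i fun y => magnetic (U y) k) K := fun i k =>
    contDiffOn_pd hK h2 (contDiffOn_magnetic hU k) i
  have hdiv : ContDiffOn ℝ 1 (fun x => blockDiv K (fun y => velocity (U y)) x) K :=
    ContDiffOn.sum fun i _ => hdv i i
  have hstress : ∀ i k, ContDiffOn ℝ 1 (fun x => stress c K U x i k) K := fun i k =>
    (contDiffOn_const.mul ((hdv i k).add (hdv k i))).sub
      ((contDiffOn_const.mul hdiv).mul contDiffOn_const)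
  have hheat : ContDiffOn ℝ 1 (fun x => heatFlux c K U x l) K := by
    refine contDiffOn_const.mul (contDiffOn_pd hK h2 ?_ l)
    exact (contDiffOn_pressure c hU hρ).div (contDiffOn_const.mul (contDiffOn_density hU))
      fun x hx => mul_ne_zero hR (hρ x hx).ne'
  have hcurl : ∀ i, ContDiffOn ℝ 1 (fun x => curl K (fun y => magnetic (U y)) x i) K := by
    intro i
    fin_cases i
    exacts [(hdb 1 2).sub (hdb 2 1), (hdb 2 0).sub (hdb 0 2), (hdb 0 1).sub (hdb 1 0)]
  have hcross : ContDiffOn ℝ 1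
      (fun x => crossProduct (curl K (fun y => magnetic (U y)) x) (magnetic (U x)) l) K := by
    simp only [cross_apply]
    fin_cases l
    exacts [((hcurl 1).mul (hb1 2)).sub ((hcurl 2).mul (hb1 1)),
      ((hcurl 2).mul (hb1 0)).sub ((hcurl 0).mul (hb1 2)),
      ((hcurl 0).mul (hb1 1)).sub ((hcurl 1).mul (hb1 0))]
  refine contDiffOn_mkState contDiffOn_const (fun k => hstress l k) ?_ (fun k => ?_)
    contDiffOn_const
  · exact ((contDiffOn_dotProduct (hstress l) hv1).sub hheat).sub (contDiffOn_const.mul hcross)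
  · exact contDiffOn_const.mul ((hdb l k).sub (hdb k l))

end Regularity

/-! ### The pointwise entropy inequality -/

section Pointwise

/-- The product rule for the contraction of the entropy variables with a flux that has no mass and
cleaning components. -/
theorem HasPrimitiveDerivAt.hasDerivAt_entropyVarsFormula_dotProduct {c : Constants}
    {U : ℝ → State} {t r' p' z' : ℝ} {v' b' : Fin 3 → ℝ}
    (h : HasPrimitiveDerivAt c U t r' v' p' b' z') (hp : 0 < GLMMHD.pressure c (U t))
    {m b : ℝ → Fin 3 → ℝ} {e : ℝ → ℝ} {F : State}
    (hF : HasDerivAt (fun s => mkState 0 (m s) (e s) (b s) 0) F t) :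
    HasDerivAt (fun s => entropyVarsFormula c (U s) ⬝ᵥ mkState 0 (m s) (e s) (b s) 0)
      (entropyVarsFormula c (U t) ⬝ᵥ F
        + ((r' * GLMMHD.pressure c (U t) - GLMMHD.density (U t) * p')
            / GLMMHD.pressure c (U t) ^ 2
          * (GLMMHD.velocity (U t) ⬝ᵥ m t - e t + GLMMHD.magnetic (U t) ⬝ᵥ b t)
        + GLMMHD.density (U t) / GLMMHD.pressure c (U t) * (v' ⬝ᵥ m t + b' ⬝ᵥ b t))) t := by
  have hc := hasDerivAt_pi.1 hF
  have hm : HasDerivAt m ![F 1, F 2, F 3] t := by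
    refine hasDerivAt_pi.2 fun i => ?_
    fin_cases i
    exacts [hc 1, hc 2, hc 3]
  have hb : HasDerivAt b ![F 5, F 6, F 7] t := by
    refine hasDerivAt_pi.2 fun i => ?_
    fin_cases i
    exacts [hc 5, hc 6, hc 7]
  have he : HasDerivAt e (F 4) t := hc 4
  have hF' : F = mkState 0 ![F 1, F 2, F 3] (F 4) ![F 5, F 6, F 7] 0 := by
    ext i
    fin_cases i
    exacts [(hc 0).unique (hasDerivAt_const t 0), rfl, rfl, rfl, rfl, rfl, rfl, rfl,
      (hc 8).unique (hasDerivAt_const t 0)]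
  have hβ := h.density.div h.pressure hp.ne'
  have hd := hβ.mul (((hasDerivAt_dotProduct h.velocity hm).sub he).add
    (hasDerivAt_dotProduct h.magnetic hb))
  have hfun : (fun s => entropyVarsFormula c (U s) ⬝ᵥ mkState 0 (m s) (e s) (b s) 0)
      = fun s => GLMMHD.density (U s) / GLMMHD.pressure c (U s)
        * (GLMMHD.velocity (U s) ⬝ᵥ m s - e s + GLMMHD.magnetic (U s) ⬝ᵥ b s) := by
    funext s
    rw [entropyVarsFormula, mkState_dotProduct, smul_dotProduct, smul_dotProduct, smul_eq_mul,
      smul_eq_mul]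
    ring
  rw [hfun]
  refine hd.congr_deriv ?_
  rw [congrArg (entropyVarsFormula c (U t) ⬝ᵥ ·) hF', entropyVarsFormula, mkState_dotProduct,
    smul_dotProduct, smul_dotProduct, smul_eq_mul, smul_eq_mul]
  simp only [Pi.add_apply, Pi.sub_apply, Pi.div_apply]
  ring

variable {Ω : Set Space} {x : Space}

theorem hasDerivAt_line (hΩ : IsOpen Ω) (hx : x ∈ Ω) {F : Type*} [NormedAddCommGroup F]
    [NormedSpace ℝ F] {f : Space → F} (hf : DifferentiableAt ℝ f x) (l : Fin 3) :
    HasDerivAt (fun s : ℝ => f (x + s • EuclideanSpace.single l 1)) (pd (closure Ω) l f x) 0 := by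
  rw [pd, fderivWithin_closure_eq hΩ f hx]
  exact hf.hasFDerivAt.hasLineDerivAt _

theorem differentiableAt_of_contDiffOn_closure (hΩ : IsOpen Ω) (hx : x ∈ Ω) {F : Type*}
    [NormedAddCommGroup F] [NormedSpace ℝ F] {f : Space → F}
    (hf : ContDiffOn ℝ 1 f (closure Ω)) : DifferentiableAt ℝ f x :=
  (hf.contDiffAt (mem_of_superset (hΩ.mem_nhds hx) subset_closure)).differentiableAt one_ne_zero

/-- The viscous stress dissipates: it is the sum of the squares of the off-diagonal strain rates
and of the differences of the diagonal ones. -/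
theorem sum_gradVec_mul_stress_nonneg (c : Constants) (hμ : 0 ≤ c.viscosity) (K : Set Space)
    (U : Space → State) (x : Space) :
    0 ≤ ∑ l, (fun k => pd K l (fun y => velocity (U y) k) x) ⬝ᵥ fun k => stress c K U x l k := by
  have h : ∑ l, (fun k => pd K l (fun y => velocity (U y) k) x) ⬝ᵥ (fun k => stress c K U x l k)
      = c.viscosity * ((pd K 0 (fun y => velocity (U y) 1) x
          + pd K 1 (fun y => velocity (U y) 0) x) ^ 2
        + (pd K 0 (fun y => velocity (U y) 2) x + pd K 2 (fun y => velocity (U y) 0) x) ^ 2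
        + (pd K 1 (fun y => velocity (U y) 2) x + pd K 2 (fun y => velocity (U y) 1) x) ^ 2
        + 2 / 3 * ((pd K 0 (fun y => velocity (U y) 0) x
            - pd K 1 (fun y => velocity (U y) 1) x) ^ 2
          + (pd K 1 (fun y => velocity (U y) 1) x - pd K 2 (fun y => velocity (U y) 2) x) ^ 2
          + (pd K 0 (fun y => velocity (U y) 0) x
            - pd K 2 (fun y => velocity (U y) 2) x) ^ 2)) := by
    simp [stress, gradVec, blockDiv, dotProduct, Fin.sum_univ_three, Matrix.one_apply]
    ring
  rw [h]
  positivity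

/-- The resistive flux dissipates: it is the square of the current. -/
theorem sum_pd_magnetic_mul_nonneg (c : Constants) (hμ : 0 ≤ c.resistivity) (K : Set Space)
    (U : Space → State) (x : Space) :
    0 ≤ ∑ l, (fun k => pd K l (fun y => magnetic (U y) k) x) ⬝ᵥ fun k =>
      c.resistivity * ((gradVec K (fun y => magnetic (U y)) x)ᵀ
        - gradVec K (fun y => magnetic (U y)) x) l k := by
  have h : (∑ l, (fun k => pd K l (fun y => magnetic (U y) k) x) ⬝ᵥ fun k =>
      c.resistivity * ((gradVec K (fun y => magnetic (U y)) x)ᵀ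
        - gradVec K (fun y => magnetic (U y)) x) l k)
      = c.resistivity * ((pd K 0 (fun y => magnetic (U y) 1) x
          - pd K 1 (fun y => magnetic (U y) 0) x) ^ 2
        + (pd K 0 (fun y => magnetic (U y) 2) x - pd K 2 (fun y => magnetic (U y) 0) x) ^ 2
        + (pd K 1 (fun y => magnetic (U y) 2) x - pd K 2 (fun y => magnetic (U y) 1) x) ^ 2) := by
    simp [gradVec, dotProduct, Fin.sum_univ_three]
    ring
  rw [h]
  positivity

/-- The work of the viscous stress and the Poynting flux of the resistive field drop out of the
entropy balance, and only the heat flux remains. -/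
theorem viscousFlux_energy_eq (c : Constants) (K : Set Space) (U : Space → State) (x : Space)
    (l : Fin 3) :
    velocity (U x) ⬝ᵥ (fun k => stress c K U x l k)
      - ((stress c K U x *ᵥ velocity (U x)) l - heatFlux c K U x l
        - c.resistivity * (crossProduct (curl K (fun y => magnetic (U y)) x) (magnetic (U x))) l)
      + magnetic (U x) ⬝ᵥ (fun k => c.resistivity * ((gradVec K (fun y => magnetic (U y)) x)ᵀ
        - gradVec K (fun y => magnetic (U y)) x) l k)
      = heatFlux c K U x l := by
  have h1 : velocity (U x) ⬝ᵥ (fun k => stress c K U x l k)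
      = (stress c K U x *ᵥ velocity (U x)) l := dotProduct_comm _ _
  rw [h1]
  have h2 : magnetic (U x) ⬝ᵥ (fun k => c.resistivity * ((gradVec K (fun y => magnetic (U y)) x)ᵀ
        - gradVec K (fun y => magnetic (U y)) x) l k)
      = -(c.resistivity
        * (crossProduct (curl K (fun y => magnetic (U y)) x) (magnetic (U x))) l) := by
    fin_cases l <;>
    · simp [gradVec, curl, cross_apply, dotProduct, Fin.sum_univ_three]
      ring
  rw [h2]
  ring

/-- The flux of the entropy balance, advective and diffusive. -/
noncomputable def totalEntropyFlux (c : Constants) (K : Set Space) (U : Space → State)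
    (l : Fin 3) (x : Space) : ℝ :=
  entropyFlux c (U x) l - entropyVars c (U x) ⬝ᵥ viscousFlux c K U x l

theorem contDiffOn_totalEntropyFlux (c : Constants) (hγ : c.adiabatic ≠ 1) (hR : c.gasConst ≠ 0)
    {K : Set Space} (hK : UniqueDiffOn ℝ K) {U : Space → State} (hU : ContDiffOn ℝ 2 U K)
    (hρ : ∀ x ∈ K, 0 < density (U x)) (hp : ∀ x ∈ K, 0 < pressure c (U x)) (l : Fin 3) :
    ContDiffOn ℝ 1 (totalEntropyFlux c K U l) K :=
  have hU1 := hU.of_le (by norm_num : (1 : WithTop ℕ∞) ≤ 2)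
  (contDiffOn_entropyFlux c hU1 hρ hp l).sub (contDiffOn_dotProduct
    (contDiffOn_pi.1 (contDiffOn_entropyVars c hγ hU1 hρ hp))
    (contDiffOn_pi.1 (contDiffOn_viscousFlux c hR hK hU hρ l)))

/-- The primitive variables along a coordinate line. -/
theorem hasPrimitiveDerivAt_line (c : Constants) (hΩ : IsOpen Ω) (hx : x ∈ Ω) {U : Space → State}
    (hU : ContDiffOn ℝ 1 U (closure Ω)) (hρ : ∀ x ∈ closure Ω, 0 < density (U x)) (l : Fin 3) :
    HasPrimitiveDerivAt c (fun s : ℝ => U (x + s • EuclideanSpace.single l 1)) 0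
      (pd (closure Ω) l (fun y => density (U y)) x)
      (fun k => pd (closure Ω) l (fun y => velocity (U y) k) x)
      (pd (closure Ω) l (fun y => pressure c (U y)) x)
      (fun k => pd (closure Ω) l (fun y => magnetic (U y) k) x)
      (pd (closure Ω) l (fun y => cleaning (U y)) x) where
  density := hasDerivAt_line hΩ hx
    (differentiableAt_of_contDiffOn_closure hΩ hx (contDiffOn_density hU)) l
  velocity := hasDerivAt_pi.2 fun k => hasDerivAt_line hΩ hx
    (differentiableAt_of_contDiffOn_closure hΩ hx (contDiffOn_velocity hU hρ k)) l
  pressure := hasDerivAt_line hΩ hx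
    (differentiableAt_of_contDiffOn_closure hΩ hx (contDiffOn_pressure c hU hρ)) l
  magnetic := hasDerivAt_pi.2 fun k => hasDerivAt_line hΩ hx
    (differentiableAt_of_contDiffOn_closure hΩ hx (contDiffOn_magnetic hU k)) l
  cleaning := hasDerivAt_line hΩ hx
    (differentiableAt_of_contDiffOn_closure hΩ hx (contDiffOn_cleaning hU)) l

theorem pd_totalEntropyFlux (c : Constants) (hγ : c.adiabatic ≠ 1) (hR : c.gasConst ≠ 0)
    (hΩ : IsBoundedLipschitzDomain Ω) (hx : x ∈ Ω) {U : Space → State}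
    (hU : ContDiffOn ℝ 2 U (closure Ω)) (hρ : ∀ x ∈ closure Ω, 0 < density (U x))
    (hp : ∀ x ∈ closure Ω, 0 < pressure c (U x)) (l : Fin 3) :
    pd (closure Ω) l (totalEntropyFlux c (closure Ω) U l) x
      = entropyVarsFormula c (U x) ⬝ᵥ (pd (closure Ω) l (fun y => advectiveFlux c (U y) l) x
        + (pd (closure Ω) l (fun y => magnetic (U y) l) x • mkState 0 (magnetic (U x))
            (velocity (U x) ⬝ᵥ magnetic (U x)) (velocity (U x)) 0
          + pd (closure Ω) l (fun y => cleaning (U y)) x • mkState 0 0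
            (velocity (U x) l * cleaning (U x)) 0 (velocity (U x) l)))
      - (entropyVarsFormula c (U x) ⬝ᵥ
          pd (closure Ω) l (fun y => viscousFlux c (closure Ω) U y l) x
        + ((pd (closure Ω) l (fun y => density (U y)) x * pressure c (U x)
            - density (U x) * pd (closure Ω) l (fun y => pressure c (U y)) x) / pressure c (U x) ^ 2
          * heatFlux c (closure Ω) U x l
        + density (U x) / pressure c (U x)
          * ((fun k => pd (closure Ω) l (fun y => velocity (U y) k) x) ⬝ᵥ
              (fun k => stress c (closure Ω) U x l k)
            + (fun k => pd (closure Ω) l (fun y => magnetic (U y) k) x) ⬝ᵥ (fun k =>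
              c.resistivity * ((gradVec (closure Ω) (fun y => magnetic (U y)) x)ᵀ
                - gradVec (closure Ω) (fun y => magnetic (U y)) x) l k)))) := by
  have hΩo := hΩ.isOpen
  have hxK : x ∈ closure Ω := subset_closure hx
  have hU1 := hU.of_le (by norm_num : (1 : WithTop ℕ∞) ≤ 2)
  have h0 : x + (0 : ℝ) • (EuclideanSpace.single l 1 : Space) = x := by simp
  have hprim := hasPrimitiveDerivAt_line c hΩo hx hU1 hρ l
  have hF := hasDerivAt_line hΩo hx (differentiableAt_of_contDiffOn_closure hΩo hx
    (contDiffOn_advectiveFlux c hU1 hρ l)) l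
  have hV := hasDerivAt_line hΩo hx (differentiableAt_of_contDiffOn_closure hΩo hx
    (contDiffOn_viscousFlux c hR hΩ.uniqueDiffOn_closure hU hρ l)) l
  have hG := hasDerivAt_line hΩo hx (differentiableAt_of_contDiffOn_closure hΩo hx
    (contDiffOn_totalEntropyFlux c hγ hR hΩ.uniqueDiffOn_closure hU hρ hp l)) l
  have h1 := hprim.hasDerivAt_entropyFlux hγ (by rw [h0]; exact hρ x hxK)
    (by rw [h0]; exact hp x hxK) l hF
  have h2 := hprim.hasDerivAt_entropyVarsFormula_dotProduct (by rw [h0]; exact hp x hxK) hV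
  have hev : (fun s : ℝ => totalEntropyFlux c (closure Ω) U l
        (x + s • EuclideanSpace.single l 1))
      =ᶠ[𝓝 0] fun s => entropyFlux c (U (x + s • EuclideanSpace.single l 1)) l
        - entropyVarsFormula c (U (x + s • EuclideanSpace.single l 1)) ⬝ᵥ
          viscousFlux c (closure Ω) U (x + s • EuclideanSpace.single l 1) l := by
    have hlim : Tendsto (fun s : ℝ => x + s • (EuclideanSpace.single l 1 : Space)) (𝓝 0) (𝓝 x) := by
      have : Continuous fun s : ℝ => x + s • (EuclideanSpace.single l 1 : Space) := by fun_prop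
      simpa using this.tendsto 0
    filter_upwards [hlim.eventually (hΩo.mem_nhds hx)] with s hs
    have hs' := subset_closure hs
    rw [totalEntropyFlux, entropyVars_eq c hγ (hρ _ hs') (hp _ hs')]
  have h3 := hG.unique ((h1.sub h2).congr_of_eventuallyEq hev)
  rw [h3]
  simp only [h0, viscousFlux_energy_eq]

/-- The heat flux dissipates, since the temperature decreases in `ρ / p`. -/
theorem pd_mul_heatFlux_nonneg (c : Constants) (hκ : 0 ≤ c.conductivity) (hR : 0 < c.gasConst)
    (hΩ : IsOpen Ω) (hx : x ∈ Ω) {U : Space → State}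
    (hU : ContDiffOn ℝ 1 U (closure Ω)) (hρ : ∀ x ∈ closure Ω, 0 < density (U x))
    (l : Fin 3) :
    0 ≤ (pd (closure Ω) l (fun y => density (U y)) x * pressure c (U x)
        - density (U x) * pd (closure Ω) l (fun y => pressure c (U y)) x) / pressure c (U x) ^ 2
      * heatFlux c (closure Ω) U x l := by
  have hxK : x ∈ closure Ω := subset_closure hx
  have hρx := hρ x hxK
  have hprim := hasPrimitiveDerivAt_line c hΩ hx hU hρ l
  have hT : ContDiffOn ℝ 1 (fun y => pressure c (U y) / (c.gasConst * density (U y)))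
      (closure Ω) :=
    (contDiffOn_pressure c hU hρ).div (contDiffOn_const.mul (contDiffOn_density hU))
      fun x hx => mul_ne_zero hR.ne' (hρ x hx).ne'
  have h1 := hasDerivAt_line hΩ hx (differentiableAt_of_contDiffOn_closure hΩ hx hT) l
  have h2 := hprim.pressure.div (hprim.density.const_mul c.gasConst)
    (by simpa using ⟨hR.ne', hρx.ne'⟩)
  have h3 := h1.unique h2
  simp only [zero_smul, add_zero] at h3
  rw [heatFlux, h3]
  generalize pd (closure Ω) l (fun y => density (U y)) x = r'
  generalize pd (closure Ω) l (fun y => pressure c (U y)) x = p'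
  have : (r' * pressure c (U x) - density (U x) * p') / pressure c (U x) ^ 2
      * (-c.conductivity * ((p' * (c.gasConst * density (U x))
        - pressure c (U x) * (c.gasConst * r')) / (c.gasConst * density (U x)) ^ 2))
      = c.conductivity / c.gasConst
        * ((r' * pressure c (U x) - density (U x) * p')
          / (pressure c (U x) * density (U x))) ^ 2 := by
    field_simp
    ring
  rw [this]
  positivity

/-- The entropy inequality at an interior point, for a state field with the time derivative `u'`
that the equation prescribes. -/
theorem entropyVarsFormula_dotProduct_add_sum_pd_le (c : Constants) (hγ : c.adiabatic ≠ 1)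
    (hμ : 0 ≤ c.viscosity) (hμR : 0 ≤ c.resistivity) (hκ : 0 ≤ c.conductivity)
    (hR : 0 < c.gasConst) (hα : 0 ≤ c.damping)
    (hΩ : IsBoundedLipschitzDomain Ω) (hx : x ∈ Ω) {U : Space → State}
    (hU : ContDiffOn ℝ 2 U (closure Ω)) (hρ : ∀ x ∈ closure Ω, 0 < density (U x))
    (hp : ∀ x ∈ closure Ω, 0 < pressure c (U x)) {u' : State}
    (heq : u' + blockDiv (closure Ω) (fun y => advectiveFlux c (U y)) x
      - blockDiv (closure Ω) (viscousFlux c (closure Ω) U) x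
      + (powellTerm (closure Ω) U x + glmTerm (closure Ω) U x) = dampingTerm c (U x)) :
    entropyVarsFormula c (U x) ⬝ᵥ u'
      + ∑ l, pd (closure Ω) l (totalEntropyFlux c (closure Ω) U l) x ≤ 0 := by
  have hxK : x ∈ closure Ω := subset_closure hx
  have hU1 := hU.of_le (by norm_num : (1 : WithTop ℕ∞) ≤ 2)
  have hβ : 0 < density (U x) / pressure c (U x) := div_pos (hρ x hxK) (hp x hxK)
  have hu' : u' = dampingTerm c (U x)
      - blockDiv (closure Ω) (fun y => advectiveFlux c (U y)) x
      + blockDiv (closure Ω) (viscousFlux c (closure Ω) U) x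
      - (powellTerm (closure Ω) U x + glmTerm (closure Ω) U x) := by
    rw [← heq]
    abel
  have hdamp : entropyVarsFormula c (U x) ⬝ᵥ dampingTerm c (U x)
      = -(density (U x) / pressure c (U x) * (c.damping * cleaning (U x) ^ 2)) := by
    rw [entropyVarsFormula, dampingTerm, mkState_dotProduct]
    simp
    ring
  have hdamp' : 0 ≤ density (U x) / pressure c (U x) * (c.damping * cleaning (U x) ^ 2) := by
    positivity
  have hs := mul_nonneg hβ.le (sum_gradVec_mul_stress_nonneg c hμ (closure Ω) U x)
  have hb := mul_nonneg hβ.le (sum_pd_magnetic_mul_nonneg c hμR (closure Ω) U x)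
  have hh := fun l => pd_mul_heatFlux_nonneg c hκ hR hΩ.isOpen hx hU1 hρ l
  have hpd := fun l => pd_totalEntropyFlux c hγ hR.ne' hΩ hx hU hρ hp l
  have hh' := Finset.sum_nonneg fun l (_ : l ∈ Finset.univ) => hh l
  simp only [hpd]
  rw [hu']
  simp only [powellTerm, glmTerm, blockDiv, dotProduct_add, dotProduct_sub, hdamp, Finset.sum_smul,
    dotProduct_sum, Finset.sum_add_distrib, Finset.sum_sub_distrib, mul_add, ← Finset.mul_sum]
  linarith

end Pointwise

/-! ### Integration of the entropy balance -/

section Integrated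

variable {c : Constants} {Ω : Set Space} {T t : ℝ} {u : ℝ → Space → State}

theorem IsSolution.contDiffOn_slice (hu : IsSolution c Ω T u) (ht : t ∈ Ioo 0 T) :
    ContDiffOn ℝ 2 (u t) (closure Ω) :=
  hu.contDiffOn.comp (f := fun x => (t, x)) (contDiff_prodMk_right t).contDiffOn
    fun _ hx => ⟨ht, hx⟩

/-- Up to the boundary of `Ω`, the time derivative is a partial derivative on space-time. -/
theorem IsSolution.hasDerivAt (hu : IsSolution c Ω T u) (ht : t ∈ Ioo 0 T) {x : Space}
    (hx : x ∈ closure Ω) :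
    HasDerivAt (fun s => u s x) (fderivWithin ℝ (fun q : ℝ × Space => u q.1 q.2)
      (Ioo 0 T ×ˢ closure Ω) (t, x) (1, 0)) t := by
  have h1 := ((hu.contDiffOn.differentiableOn two_ne_zero) (t, x) ⟨ht, hx⟩).hasFDerivWithinAt
  have h2 : HasDerivWithinAt (fun s : ℝ => (s, x)) (1, 0) (Ioo 0 T) t :=
    ((hasDerivAt_id t).prodMk (hasDerivAt_const t x)).hasDerivWithinAt
  have h3 : MapsTo (fun s : ℝ => (s, x)) (Ioo 0 T) (Ioo 0 T ×ˢ closure Ω) := fun s hs => ⟨hs, hx⟩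
  exact (h1.comp_hasDerivWithinAt t h2 h3).hasDerivAt (isOpen_Ioo.mem_nhds ht)

theorem IsSolution.continuousOn_deriv (hΩ : IsBoundedLipschitzDomain Ω) (hu : IsSolution c Ω T u)
    (ht : t ∈ Ioo 0 T) : ContinuousOn (fun x => deriv (fun s => u s x) t) (closure Ω) := by
  have hmaps : MapsTo (fun x : Space => (t, x)) (closure Ω) (Ioo 0 T ×ˢ closure Ω) :=
    fun x hx => ⟨ht, hx⟩
  have h1 := ((hu.contDiffOn.continuousOn_fderivWithin
    (isOpen_Ioo.uniqueDiffOn.prod hΩ.uniqueDiffOn_closure) (by norm_num)).comp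
    (by fun_prop) hmaps).clm_apply (continuousOn_const (c := ((1, 0) : ℝ × Space)))
  exact h1.congr fun x hx => (hu.hasDerivAt ht hx).deriv

theorem IsSolution.deriv_entropy (hγ : c.adiabatic ≠ 1) (hu : IsSolution c Ω T u)
    (ht : t ∈ Ioo 0 T) {x : Space} (hx : x ∈ closure Ω) :
    deriv (fun s => entropy c (u s x)) t
      = entropyVarsFormula c (u t x) ⬝ᵥ deriv (fun s => u s x) t := by
  have hd := hu.hasDerivAt ht hx
  have hρ := hu.density_pos t ht x hx
  obtain ⟨r', v', p', b', z', h⟩ := exists_hasPrimitiveDerivAt c hd hρ.ne'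
  rw [hd.deriv]
  exact (h.hasDerivAt_entropy_dotProduct hγ hd hρ (hu.pressure_pos t ht x hx)).deriv

theorem IsSolution.integrableOn_deriv_entropy (hγ : c.adiabatic ≠ 1)
    (hΩ : IsBoundedLipschitzDomain Ω) (hu : IsSolution c Ω T u) (ht : t ∈ Ioo 0 T) :
    IntegrableOn (fun x => deriv (fun s => entropy c (u s x)) t) Ω := by
  have hρ := hu.density_pos t ht
  have hp := hu.pressure_pos t ht
  refine hΩ.integrableOn (ContinuousOn.congr (f := fun x =>
    entropyVars c (u t x) ⬝ᵥ deriv (fun s => u s x) t) ?_ fun x hx => ?_)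
  · have h1 := (contDiffOn_entropyVars c hγ (hu.contDiffOn_slice ht) hρ hp).continuousOn
    have h2 := hu.continuousOn_deriv hΩ ht
    rw [continuousOn_pi] at h1 h2
    exact continuousOn_finsetSum _ fun k _ => (h1 k).mul (h2 k)
  · simp only [hu.deriv_entropy hγ ht hx, entropyVars_eq c hγ (hρ x hx) (hp x hx)]

theorem boundaryFlux_eq_sum (c : Constants) (Ω : Set Space) (U : Space → State) :
    boundaryFlux c Ω U = fun x => ∑ l, totalEntropyFlux c (closure Ω) U l x
      * inner ℝ (EuclideanSpace.single l (1 : ℝ)) (outwardNormal Ω x) := by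
  funext x
  simp only [boundaryFlux, totalEntropyFlux, sub_mul, Finset.sum_sub_distrib, dotProduct_sum,
    dotProduct_smul, smul_eq_mul, EuclideanSpace.inner_single_left, map_one, one_mul]
  congr 1
  exact Finset.sum_congr rfl fun l _ => mul_comm _ _

end Integrated

end GLMMHD

theorem theorem1 (c : GLMMHD.Constants)
    (h_adiabatic : 1 < c.adiabatic) (h_viscosity : 0 ≤ c.viscosity)
    (h_resistivity : 0 ≤ c.resistivity) (h_conductivity : 0 ≤ c.conductivity)
    (h_gasConst : 0 < c.gasConst) (h_damping : 0 ≤ c.damping)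
    (Ω : Set GLMMHD.Space) (hΩ : GLMMHD.IsBoundedLipschitzDomain Ω)
    (T : ℝ) (u : ℝ → GLMMHD.Space → GLMMHD.State) (hu : GLMMHD.IsSolution c Ω T u)
    (t : ℝ) (ht : t ∈ Set.Ioo 0 T) :
    MeasureTheory.IntegrableOn (fun x => deriv (fun s => GLMMHD.entropy c (u s x)) t) Ω ∧
    MeasureTheory.Integrable (GLMMHD.boundaryFlux c Ω (u t)) (GLMMHD.surfaceMeasure Ω) ∧
    (∫ x in Ω, deriv (fun s => GLMMHD.entropy c (u s x)) t)
      + ∫ x, GLMMHD.boundaryFlux c Ω (u t) x ∂(GLMMHD.surfaceMeasure Ω) ≤ 0 := by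
  have hγ : c.adiabatic ≠ 1 := h_adiabatic.ne'
  have hU := hu.contDiffOn_slice ht
  have hρ := hu.density_pos t ht
  have hp := hu.pressure_pos t ht
  have hS := hu.integrableOn_deriv_entropy hγ hΩ ht
  have hG := GLMMHD.contDiffOn_totalEntropyFlux c hγ h_gasConst.ne' hΩ.uniqueDiffOn_closure
    hU hρ hp
  have hB := fun l => hΩ.integrable_mul_inner (hG l).continuousOn (EuclideanSpace.single l 1)
  have hD := fun l => hΩ.integrableOn_fderivWithin (hG l) (EuclideanSpace.single l 1)
  refine ⟨hS, ?_, ?_⟩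
  · rw [GLMMHD.boundaryFlux_eq_sum]
    exact integrable_finsetSum _ fun l _ => hB l
  · rw [GLMMHD.boundaryFlux_eq_sum, integral_finsetSum _ fun l _ => hB l]
    simp only [← hΩ.integral_fderivWithin (hG _)]
    rw [← integral_finsetSum _ fun l _ => hD l,
      ← integral_add hS (integrable_finsetSum _ fun l _ => hD l)]
    refine setIntegral_nonpos hΩ.isOpen.measurableSet fun x hx => ?_
    rw [hu.deriv_entropy hγ ht (subset_closure hx)]
    exact GLMMHD.entropyVarsFormula_dotProduct_add_sum_pd_le c hγ h_viscosity h_resistivity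
      h_conductivity h_gasConst h_damping hΩ hx hU hρ hp (hu.equation t ht x hx)
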